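/- Let $(M,g_M)$ and $(N,g_N)$ be two smooth connected Riemannian manifolds (without boundary) of dimensions $m$ and $n$, with $p=m+n>2$, and let $\rho:M\to\mathbb{R}$ be a positive smooth function. A metric $h$ is called Einstein, with Einstein constant $c\in\mathbb{R}$, if $\mathrm{Ric}(h)=c\,h$. Write $D\,d\rho$ for the Hessian of $\rho$ with respect to the Levi-Civita connection of $g_M$, $\Delta\rho=-\mathrm{tr}_{g_M}(D\,d\rho)$ for its positive Laplacian, and $|d\rho|$ for the norm of $d\rho$ with respect to $g_M$. For $\epsilon\in\mathbb{R}$ consider the equation on $M$ $$\mathrm{Ric}(g_M)+(p-2)\frac{D\,d\rho}{\rho}=\epsilon\, g_M .\qquad (\ast)$$ 1. If $n>0$, then $g=\rho^{-2}(g_M+g_N)$ is an Einstein metric on $M\times N$ if and only if there is a constant $\epsilon$ such that $g_N$ is an Einstein metric with Einstein constant $\epsilon$ and $(\ast)$ holds. 2. If $n=0$ (so that $N$ is a point), then $g=\rho^{-2}g_M$ is an Einstein metric on $M$ if $(\ast)$ holds for some constant $\epsilon$. In either case, the Einstein constant $\lambda$ of $g$ is related to $\epsilon$ by $$\lambda=\epsilon\rho^2-\rho\,\Delta\rho-(p-1)|d\rho|^2\quad\text{at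 every point of } M.$$ -/

import Mathlib

set_option maxSynthPendingDepth 3

open scoped Manifold ContDiff

noncomputable section

namespace ConfEinstein

/-! ### Levi-Civita calculus on a vector space

`G : E → E →L[ℝ] E →L[ℝ] ℝ` is a field of bilinear forms, the coordinate expression of a metric. -/

section Flat

variable {E : Type*} [NormedAddCommGroup E] [NormedSpace ℝ E]

/-- Right-hand side of the Koszul formula for constant vector fields, as a function of the
derivative `D` of the metric: see `koszul_apply`. -/
def koszul (D : E →L[ℝ] E →L[ℝ] E →L[ℝ] ℝ) : E →L[ℝ] E →L[ℝ] E →L[ℝ] ℝ :=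
  (1 / 2 : ℝ) • (D + D.flip -
    ((ContinuousLinearMap.flipₗᵢ ℝ E E ℝ : (E →L[ℝ] E →L[ℝ] ℝ) ≃ₗᵢ[ℝ] (E →L[ℝ] E →L[ℝ] ℝ)) :
      (E →L[ℝ] E →L[ℝ] ℝ) →L[ℝ] (E →L[ℝ] E →L[ℝ] ℝ)).comp D.flip)

theorem koszul_apply (D : E →L[ℝ] E →L[ℝ] E →L[ℝ] ℝ) (v w z : E) :
    koszul D v w z = (1 / 2) * (D v w z + D w v z - D z v w) := rfl

/-- Christoffel symbols at `y`: `christoffel G y v w` is the vector `∇_v w` (for constant `v`, `w`),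
that is, the vector whose `G y`-dual is the Koszul covector. -/
def christoffel (G : E → E →L[ℝ] E →L[ℝ] ℝ) (y : E) : E →L[ℝ] E →L[ℝ] E :=
  (ContinuousLinearMap.compL ℝ E (E →L[ℝ] ℝ) E (G y).inverse).comp (koszul (fderiv ℝ G y))

theorem christoffel_apply (G : E → E →L[ℝ] E →L[ℝ] ℝ) (y v w : E) :
    christoffel G y v w = (G y).inverse (koszul (fderiv ℝ G y) v w) := rfl

/-- The endomorphism `u ↦ R(u, v) w` at `y`, where
`R(u, v) w = ∇_u ∇_v w - ∇_v ∇_u w - ∇_[u, v] w`: see `curvature_apply`. -/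
def curvature (G : E → E →L[ℝ] E →L[ℝ] ℝ) (y v w : E) : E →L[ℝ] E :=
  ((fderiv ℝ (christoffel G) y).flip v).flip w - (fderiv ℝ (christoffel G) y v).flip w
    + (christoffel G y).flip (christoffel G y v w)
    - (christoffel G y v).comp ((christoffel G y).flip w)

theorem curvature_apply (G : E → E →L[ℝ] E →L[ℝ] ℝ) (y u v w : E) :
    curvature G y v w u =
      fderiv ℝ (christoffel G) y u v w - fderiv ℝ (christoffel G) y v u w
        + christoffel G y u (christoffel G y v w) - christoffel G y v (christoffel G y u w) := rfl

/-- Ricci tensor in coordinates: the trace of `u ↦ R(u, v) w`. -/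
def coordRicci (G : E → E →L[ℝ] E →L[ℝ] ℝ) (y v w : E) : ℝ :=
  LinearMap.trace ℝ E (curvature G y v w : E →ₗ[ℝ] E)

/-- Hessian `D df` in coordinates: see `coordHessian_apply`. -/
def coordHessian (G : E → E →L[ℝ] E →L[ℝ] ℝ) (f : E → ℝ) (y : E) : E →L[ℝ] E →L[ℝ] ℝ :=
  fderiv ℝ (fderiv ℝ f) y -
    (ContinuousLinearMap.compL ℝ E E ℝ (fderiv ℝ f y)).comp (christoffel G y)

theorem coordHessian_apply (G : E → E →L[ℝ] E →L[ℝ] ℝ) (f : E → ℝ) (y v w : E) :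
    coordHessian G f y v w =
      fderiv ℝ (fderiv ℝ f) y v w - fderiv ℝ f y (christoffel G y v w) := rfl

end Flat

/-- The pullback `A^* B` of a bilinear form: see `pullbackForm_apply`. -/
def pullbackForm {V W : Type*} [AddCommGroup V] [Module ℝ V] [TopologicalSpace V]
    [AddCommGroup W] [Module ℝ W] [TopologicalSpace W]
    (B : W →L[ℝ] W →L[ℝ] ℝ) (A : V →L[ℝ] W) : V →L[ℝ] V →L[ℝ] ℝ :=
  (ContinuousLinearMap.precomp ℝ A).comp (B.comp A)

theorem pullbackForm_apply {V W : Type*} [AddCommGroup V] [Module ℝ V] [TopologicalSpace V]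
    [AddCommGroup W] [Module ℝ W] [TopologicalSpace W]
    (B : W →L[ℝ] W →L[ℝ] ℝ) (A : V →L[ℝ] W) (v w : V) :
    pullbackForm B A v w = B (A v) (A w) := rfl

/-! ### Tensors on a manifold (without boundary) -/

section Manifold

variable {E : Type*} [NormedAddCommGroup E] [NormedSpace ℝ E]
  {H : Type*} [TopologicalSpace H] (I : ModelWithCorners ℝ E H)
  {M : Type*} [TopologicalSpace M] [ChartedSpace H M]

/-- A (not necessarily symmetric, definite or smooth) field of bilinear forms on the tangent
spaces. -/
abbrev BilinField (M : Type*) [TopologicalSpace M] [ChartedSpace H M] : Type _ :=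
  ∀ x : M, TangentSpace I x →L[ℝ] TangentSpace I x →L[ℝ] ℝ

variable {I}

/-- Coordinate expression of `g` in the chart around `x₀`: the pullback of `g` under the inverse
of the chart. -/
def coordMetric (g : BilinField I M) (x₀ : M) (y : E) : E →L[ℝ] E →L[ℝ] ℝ :=
  pullbackForm (V := TangentSpace 𝓘(ℝ, E) y) (g ((extChartAt I x₀).symm y))
    (mfderiv 𝓘(ℝ, E) I (extChartAt I x₀).symm y)

/-- Ricci tensor of `g` at `x`, computed in the chart around `x`. -/
def ricci (g : BilinField I M) (x : M) (v w : TangentSpace I x) : ℝ :=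
  coordRicci (coordMetric g x) (extChartAt I x x)
    (mfderiv I 𝓘(ℝ, E) (extChartAt I x) x v) (mfderiv I 𝓘(ℝ, E) (extChartAt I x) x w)

/-- Hessian `D df` of a function with respect to the Levi-Civita connection of `g` at `x`,
computed in the chart around `x`. -/
def hessian (g : BilinField I M) (f : M → ℝ) : BilinField I M := fun x =>
  pullbackForm (V := TangentSpace I x) (W := E)
    (coordHessian (coordMetric g x) (f ∘ (extChartAt I x).symm) (extChartAt I x x))
    (mfderiv I 𝓘(ℝ, E) (extChartAt I x) x)

/-- The positive Laplace operator `Δ f = - tr_g (D df)`; the inverse of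
`g x : T_x M → T_x^* M` raises an index. -/
def laplacian (g : BilinField I M) (f : M → ℝ) (x : M) : ℝ :=
  - LinearMap.trace ℝ (TangentSpace I x)
      (((g x).inverse.comp (hessian g f x) : TangentSpace I x →L[ℝ] TangentSpace I x) :
        TangentSpace I x →ₗ[ℝ] TangentSpace I x)

/-- The differential of a function, as a covector at `x`. -/
def differential (I : ModelWithCorners ℝ E H) {M : Type*} [TopologicalSpace M] [ChartedSpace H M]
    (f : M → ℝ) (x : M) : TangentSpace I x →L[ℝ] ℝ :=
  mfderiv I 𝓘(ℝ, ℝ) f x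

/-- `|df|²` with respect to `g`. -/
def gradNormSq (g : BilinField I M) (f : M → ℝ) (x : M) : ℝ :=
  differential I f x ((g x).inverse (differential I f x))

/-- `g` is Einstein with Einstein constant `c`: `Ric(g) = c g`. -/
def IsEinstein (g : BilinField I M) (c : ℝ) : Prop :=
  ∀ (x : M) (v w : TangentSpace I x), ricci g x v w = c * g x v w

/-- The conformal metric `ρ⁻² g`. -/
def conformal (ρ : M → ℝ) (g : BilinField I M) : BilinField I M := fun x => ((ρ x) ^ 2)⁻¹ • g x

end Manifold

section Product

variable {E : Type*} [NormedAddCommGroup E] [NormedSpace ℝ E]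
  {H : Type*} [TopologicalSpace H] {I : ModelWithCorners ℝ E H}
  {M : Type*} [TopologicalSpace M] [ChartedSpace H M]
  {E' : Type*} [NormedAddCommGroup E'] [NormedSpace ℝ E']
  {H' : Type*} [TopologicalSpace H'] {J : ModelWithCorners ℝ E' H'}
  {N : Type*} [TopologicalSpace N] [ChartedSpace H' N]

/-- The product metric `gM + gN` on `M × N`: the sum of the pullbacks under the projections. -/
def productMetric (gM : BilinField I M) (gN : BilinField J N) : BilinField (I.prod J) (M × N) :=
  fun z =>
    pullbackForm (gM z.1) (mfderiv (I.prod J) I (Prod.fst : M × N → M) z) +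
      pullbackForm (gN z.2) (mfderiv (I.prod J) J (Prod.snd : M × N → N) z)

end Product

/-- A smooth Riemannian metric on an `m`-dimensional manifold. -/
abbrev SmoothMetric (m : ℕ) (M : Type*) [TopologicalSpace M]
    [ChartedSpace (EuclideanSpace ℝ (Fin m)) M] [IsManifold (𝓡 m) ∞ M] : Type _ :=
  Bundle.ContMDiffRiemannianMetric (𝓡 m) ∞ (EuclideanSpace ℝ (Fin m))
    (fun x : M => TangentSpace (𝓡 m) x)

/-- The equation `Ric(g) + (p - 2) D dρ / ρ = ε g`. -/
def QuasiEinsteinLike {m : ℕ} {M : Type*} [TopologicalSpace M]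
    [ChartedSpace (EuclideanSpace ℝ (Fin m)) M]
    (p : ℕ) (g : BilinField (𝓡 m) M) (ρ : M → ℝ) (ε : ℝ) : Prop :=
  ∀ (x : M) (v w : TangentSpace (𝓡 m) x),
    ricci g x v w + ((p : ℝ) - 2) * (hessian g ρ x v w / ρ x) = ε * g x v w

end ConfEinstein

end

/-!
The proof rests on three facts about the Ricci tensor.

* Conformal change (`ricci_conformal`): on a manifold of dimension `p`,
  `Ric(ρ⁻² g) = Ric(g) + (p - 2) D dρ / ρ - μ g` with `μ = Δρ / ρ + (p - 1) |dρ|² / ρ²`.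
* Products (`ricci_productMetric`): `Ric(g_M + g_N) = Ric(g_M) + Ric(g_N)`, and the Hessian, the
  Laplacian and the gradient norm of a function on `M` are the same on `M × N` as on `M`.
* Schur's lemma (`exists_eq_const_of_ricci_eq`): if `Ric(g) = l g` with a function `l`, on a
  connected manifold of dimension greater than `2`, then `l` is constant.

Hence `ρ⁻² (g_M + g_N)` is Einstein with constant `c` if and only if
`Ric(g_M) + Ric(g_N) + (p - 2) D dρ / ρ = (c ρ⁻² + μ) (g_M + g_N)` at all points of `M × N`
(`isEinstein_conformal_product_iff`). Restricted to vectors tangent to `N` this says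
`Ric(g_N) = (c ρ⁻² + μ) g_N`; as `g_N ≠ 0`, the function `c ρ⁻² + μ` on `M` is a constant `ε`,
which is the relation between `c` and `ε`, and the equation on `M` follows by restricting to vectors
tangent to `M`. Conversely, the two equations with the constant `ε` make `ρ⁻² (g_M + g_N)` Einstein
with the variable factor `(ε - μ) ρ²`, which is constant by Schur's lemma. The case `n = 0` is the
same with `M` in place of `M × N`.

The three facts are first proved in coordinates, for a metric on an open set of a vector space.
There the Christoffel symbols are characterized as the torsion-free connection compatible with the
metric (`christoffel_eq_of_compatible`), which identifies them for pulled back, conformal and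
product metrics; the curvature follows by differentiation. Since the Ricci tensor at `x` is defined
in the chart around `x`, Schur's lemma on a manifold needs its independence of the chart
(`coordRicci_pullback`). The same naturality allows one to assume, in the twice contracted second
Bianchi identity behind Schur's lemma, that the Christoffel symbols vanish at the point in question.
-/

noncomputable section

namespace ConfEinstein

/-! ### Metrics in coordinates and their Levi-Civita connection -/

section Coordinates

variable {E : Type*} [NormedAddCommGroup E] [NormedSpace ℝ E]

/-- `G` is the coordinate expression, on the open set `U`, of a smooth pseudo-Riemannian metric. -/
structure IsMetricOn (G : E → E →L[ℝ] E →L[ℝ] ℝ) (U : Set E) : Prop where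
  isOpen : IsOpen U
  contDiffOn : ContDiffOn ℝ ∞ G U
  symm : ∀ y ∈ U, ∀ v w, G y v w = G y w v
  isInvertible : ∀ y ∈ U, (G y).IsInvertible

theorem koszul_symm {D : E →L[ℝ] E →L[ℝ] E →L[ℝ] ℝ} (hD : ∀ u v w, D u v w = D u w v)
    (v w : E) : koszul D v w = koszul D w v := by
  ext z
  simp only [koszul_apply, hD z v w]
  ring

theorem minSmoothness_two_le_infty : minSmoothness ℝ 2 ≤ ∞ := by
  rw [minSmoothness_of_isRCLikeNormedField]
  exact WithTop.coe_le_coe.2 (le_top : (2 : ℕ∞) ≤ ⊤)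

theorem isInvertible_of_nondegenerate [FiniteDimensional ℝ E] {B : E →L[ℝ] E →L[ℝ] ℝ}
    (hB : ∀ v, (∀ w, B v w = 0) → v = 0) : B.IsInvertible := by
  have hinj : Function.Injective (B : E →ₗ[ℝ] E →L[ℝ] ℝ) :=
    (injective_iff_map_eq_zero _).2 fun v hv => hB v fun w => DFunLike.congr_fun hv w
  have hdim : Module.finrank ℝ E = Module.finrank ℝ (E →L[ℝ] ℝ) := by
    rw [← (LinearMap.toContinuousLinearMap : (E →ₗ[ℝ] ℝ) ≃ₗ[ℝ] (E →L[ℝ] ℝ)).finrank_eq]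
    exact (Subspace.dual_finrank_eq (K := ℝ) (V := E)).symm
  exact ⟨(LinearEquiv.ofInjectiveOfFinrankEq _ hinj hdim).toContinuousLinearEquiv, by ext; rfl⟩

/-- The Levi-Civita connection is the only torsion-free connection compatible with the metric. -/
theorem christoffel_eq_of_compatible {G : E → E →L[ℝ] E →L[ℝ] ℝ} {y : E}
    (hs : ∀ v w, G y v w = G y w v) (hi : (G y).IsInvertible) (C : E → E → E)
    (hC : ∀ v w, C v w = C w v)
    (hcomp : ∀ u v w, fderiv ℝ G y u v w = G y (C u v) w + G y v (C u w)) (v w : E) :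
    christoffel G y v w = C v w := by
  rw [christoffel_apply, hi.inverse_apply_eq]
  ext z
  rw [koszul_apply, hcomp, hcomp, hcomp, hs (C z v) w, hs v (C w z), hs v (C z w), hC w v, hC z v,
    hC w z]
  ring

namespace IsMetricOn

variable {G : E → E →L[ℝ] E →L[ℝ] ℝ} {U : Set E} (h : IsMetricOn G U) {y : E}
include h

theorem mem_nhds (hy : y ∈ U) : U ∈ nhds y := h.isOpen.mem_nhds hy

theorem contDiffAt (hy : y ∈ U) : ContDiffAt ℝ ∞ G y :=
  h.contDiffOn.contDiffAt (h.mem_nhds hy)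

theorem differentiableAt (hy : y ∈ U) : DifferentiableAt ℝ G y :=
  (h.contDiffAt hy).differentiableAt (by simp)

theorem hasFDerivAt (hy : y ∈ U) : HasFDerivAt G (fderiv ℝ G y) y :=
  (h.differentiableAt hy).hasFDerivAt

theorem contDiffOn_fderiv : ContDiffOn ℝ ∞ (fderiv ℝ G) U :=
  h.contDiffOn.fderiv_of_isOpen h.isOpen (by simp)

theorem hasFDerivAt_fderiv (hy : y ∈ U) :
    HasFDerivAt (fderiv ℝ G) (fderiv ℝ (fderiv ℝ G) y) y :=
  ((h.contDiffOn_fderiv.contDiffAt (h.mem_nhds hy)).differentiableAt (by simp)).hasFDerivAt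

theorem fderiv_fderiv_symm (hy : y ∈ U) (a u : E) :
    fderiv ℝ (fderiv ℝ G) y a u = fderiv ℝ (fderiv ℝ G) y u a :=
  ((h.contDiffAt hy).isSymmSndFDerivAt minSmoothness_two_le_infty).eq a u

theorem fderiv_symm (hy : y ∈ U) (u v w : E) : fderiv ℝ G y u v w = fderiv ℝ G y u w v := by
  have h1 := ((h.hasFDerivAt hy).clm_apply (hasFDerivAt_const v y)).clm_apply
    (hasFDerivAt_const w y)
  have h2 := ((h.hasFDerivAt hy).clm_apply (hasFDerivAt_const w y)).clm_apply
    (hasFDerivAt_const v y)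
  have h3 := h2.congr_of_eventuallyEq
    (Filter.eventually_of_mem (h.mem_nhds hy) fun z hz => h.symm z hz v w)
  simpa using DFunLike.congr_fun (h1.unique h3) u

theorem christoffel_symm (hy : y ∈ U) (v w : E) : christoffel G y v w = christoffel G y w v := by
  rw [christoffel_apply, christoffel_apply, koszul_symm (h.fderiv_symm hy)]

theorem apply_christoffel (hy : y ∈ U) (v w : E) :
    G y (christoffel G y v w) = koszul (fderiv ℝ G y) v w := by
  rw [christoffel_apply, (h.isInvertible y hy).self_apply_inverse]

/-- Compatibility of the Levi-Civita connection with the metric. -/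
theorem fderiv_apply (hy : y ∈ U) (u v w : E) :
    fderiv ℝ G y u v w = G y (christoffel G y u v) w + G y v (christoffel G y u w) := by
  rw [h.symm y hy v, h.apply_christoffel hy, h.apply_christoffel hy, koszul_apply, koszul_apply,
    h.fderiv_symm hy u w v, h.fderiv_symm hy v u w, h.fderiv_symm hy w u v]
  ring

variable [FiniteDimensional ℝ E]

theorem contDiffOn_inverse : ContDiffOn ℝ ∞ (fun y => (G y).inverse) U := by
  have := FiniteDimensional.complete ℝ E
  intro y hy
  exact ((h.isInvertible y hy).contDiffAt_map_inverse.comp y (h.contDiffAt hy)).contDiffWithinAt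

theorem contDiffOn_christoffel : ContDiffOn ℝ ∞ (christoffel G) U := by
  have := FiniteDimensional.complete ℝ E
  rw [contDiffOn_clm_apply]
  intro v
  rw [contDiffOn_clm_apply]
  intro w
  have hk : ContDiffOn ℝ ∞ (fun y => koszul (fderiv ℝ G y) v w) U := by
    rw [contDiffOn_clm_apply]
    intro z
    have hD (a b c : E) : ContDiffOn ℝ ∞ (fun y => fderiv ℝ G y a b c) U :=
      ((h.contDiffOn_fderiv.clm_apply contDiffOn_const).clm_apply contDiffOn_const).clm_apply
        contDiffOn_const
    simp only [koszul_apply]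
    exact contDiffOn_const.mul (((hD v w z).add (hD w v z)).sub (hD z v w))
  exact h.contDiffOn_inverse.clm_apply hk

theorem hasFDerivAt_christoffel (hy : y ∈ U) :
    HasFDerivAt (christoffel G) (fderiv ℝ (christoffel G) y) y :=
  ((h.contDiffOn_christoffel.contDiffAt (h.mem_nhds hy)).differentiableAt (by simp)).hasFDerivAt

/-- The derivative of the compatibility of the connection with the metric. -/
theorem fderiv_fderiv_apply (hy : y ∈ U) (a u v w : E) :
    fderiv ℝ (fderiv ℝ G) y a u v w =
      fderiv ℝ G y a (christoffel G y u v) w + G y (fderiv ℝ (christoffel G) y a u v) w +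
      (fderiv ℝ G y a v (christoffel G y u w) + G y v (fderiv ℝ (christoffel G) y a u w)) := by
  have hΓ (v : E) := ((h.hasFDerivAt_christoffel hy).clm_apply (hasFDerivAt_const u y)).clm_apply
    (hasFDerivAt_const v y)
  have h1 := (((h.hasFDerivAt_fderiv hy).clm_apply (hasFDerivAt_const u y)).clm_apply
    (hasFDerivAt_const v y)).clm_apply (hasFDerivAt_const w y)
  have h2 := (((h.hasFDerivAt hy).clm_apply (hΓ v)).clm_apply (hasFDerivAt_const w y)).add
    (((h.hasFDerivAt hy).clm_apply (hasFDerivAt_const v y)).clm_apply (hΓ w))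
  have h3 := h2.congr_of_eventuallyEq
    (Filter.eventually_of_mem (h.mem_nhds hy) fun z hz => h.fderiv_apply hz u v w)
  have := DFunLike.congr_fun (h1.unique h3) a
  simp at this
  rw [this]
  ring

/-- The curvature endomorphisms are skew-adjoint. -/
theorem curvature_skew (hy : y ∈ U) (u v w z : E) :
    G y (curvature G y v w u) z = - G y w (curvature G y v z u) := by
  have h1 := h.fderiv_fderiv_apply hy u v w z
  have h2 := h.fderiv_fderiv_apply hy v u w z
  rw [h.fderiv_fderiv_symm hy u v] at h1
  simp only [h.fderiv_apply hy] at h1 h2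
  simp only [curvature_apply, map_add, map_sub, add_apply, sub_apply]
  linarith

end IsMetricOn

end Coordinates

/-! ### Change of coordinates -/

section Pullback

variable {E : Type*} [NormedAddCommGroup E] [NormedSpace ℝ E]

/-- The pullback `φ^* G` of a field of bilinear forms on `E` under a map `φ : E → E`. -/
def pullbackMetric (φ : E → E) (G : E → E →L[ℝ] E →L[ℝ] ℝ) (y : E) : E →L[ℝ] E →L[ℝ] ℝ :=
  pullbackForm (G (φ y)) (fderiv ℝ φ y)

theorem pullbackMetric_apply (φ : E → E) (G : E → E →L[ℝ] E →L[ℝ] ℝ) (y v w : E) :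
    pullbackMetric φ G y v w = G (φ y) (fderiv ℝ φ y v) (fderiv ℝ φ y w) := rfl

/-- `φ` is a smooth map of the open set `V` to `U` whose differential is invertible on `V`. -/
structure IsLocalDiffeoOn (φ : E → E) (V U : Set E) : Prop where
  isOpen : IsOpen V
  contDiffOn : ContDiffOn ℝ ∞ φ V
  mapsTo : Set.MapsTo φ V U
  isInvertible : ∀ y ∈ V, (fderiv ℝ φ y).IsInvertible

namespace IsLocalDiffeoOn

variable {φ : E → E} {V U : Set E} (hφ : IsLocalDiffeoOn φ V U) {y : E}
include hφ

theorem mem_nhds (hy : y ∈ V) : V ∈ nhds y := hφ.isOpen.mem_nhds hy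

theorem contDiffAt (hy : y ∈ V) : ContDiffAt ℝ ∞ φ y :=
  hφ.contDiffOn.contDiffAt (hφ.mem_nhds hy)

theorem hasFDerivAt (hy : y ∈ V) : HasFDerivAt φ (fderiv ℝ φ y) y :=
  ((hφ.contDiffAt hy).differentiableAt (by simp)).hasFDerivAt

theorem contDiffOn_fderiv : ContDiffOn ℝ ∞ (fderiv ℝ φ) V :=
  hφ.contDiffOn.fderiv_of_isOpen hφ.isOpen (by simp)

theorem hasFDerivAt_fderiv (hy : y ∈ V) :
    HasFDerivAt (fderiv ℝ φ) (fderiv ℝ (fderiv ℝ φ) y) y :=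
  ((hφ.contDiffOn_fderiv.contDiffAt (hφ.mem_nhds hy)).differentiableAt (by simp)).hasFDerivAt

theorem fderiv_fderiv_symm (hy : y ∈ V) (a u : E) :
    fderiv ℝ (fderiv ℝ φ) y a u = fderiv ℝ (fderiv ℝ φ) y u a :=
  ((hφ.contDiffAt hy).isSymmSndFDerivAt minSmoothness_two_le_infty).eq a u

theorem contDiffOn_fderiv_fderiv : ContDiffOn ℝ ∞ (fderiv ℝ (fderiv ℝ φ)) V :=
  hφ.contDiffOn_fderiv.fderiv_of_isOpen hφ.isOpen (by simp)

theorem hasFDerivAt_fderiv_fderiv (hy : y ∈ V) :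
    HasFDerivAt (fderiv ℝ (fderiv ℝ φ)) (fderiv ℝ (fderiv ℝ (fderiv ℝ φ)) y) y :=
  ((hφ.contDiffOn_fderiv_fderiv.contDiffAt (hφ.mem_nhds hy)).differentiableAt
    (by simp)).hasFDerivAt

theorem fderiv_fderiv_fderiv_symm (hy : y ∈ V) (a u : E) :
    fderiv ℝ (fderiv ℝ (fderiv ℝ φ)) y a u = fderiv ℝ (fderiv ℝ (fderiv ℝ φ)) y u a :=
  ((hφ.contDiffOn_fderiv.contDiffAt (hφ.mem_nhds hy)).isSymmSndFDerivAt
    minSmoothness_two_le_infty).eq a u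

variable {G : E → E →L[ℝ] E →L[ℝ] ℝ} (hG : IsMetricOn G U)
include hG

variable [FiniteDimensional ℝ E]

theorem isMetricOn_pullback : IsMetricOn (pullbackMetric φ G) V where
  isOpen := hφ.isOpen
  contDiffOn := by
    have := FiniteDimensional.complete ℝ E
    rw [contDiffOn_clm_apply]
    intro v
    rw [contDiffOn_clm_apply]
    intro w
    simp only [pullbackMetric_apply]
    exact ((hG.contDiffOn.comp hφ.contDiffOn hφ.mapsTo).clm_apply
      (hφ.contDiffOn_fderiv.clm_apply contDiffOn_const)).clm_apply
      (hφ.contDiffOn_fderiv.clm_apply contDiffOn_const)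
  symm y hy v w := hG.symm _ (hφ.mapsTo hy) _ _
  isInvertible y hy := by
    apply isInvertible_of_nondegenerate
    intro v hv
    apply (hφ.isInvertible y hy).injective
    apply (hG.isInvertible _ (hφ.mapsTo hy)).injective
    ext z
    obtain ⟨w, rfl⟩ := (hφ.isInvertible y hy).surjective z
    simpa [pullbackMetric_apply] using hv w

/-- The derivative of the pulled back metric. -/
theorem fderiv_pullbackMetric_apply (hy : y ∈ V) (u v w : E) :
    fderiv ℝ (pullbackMetric φ G) y u v w =
      fderiv ℝ G (φ y) (fderiv ℝ φ y u) (fderiv ℝ φ y v) (fderiv ℝ φ y w) +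
      G (φ y) (fderiv ℝ (fderiv ℝ φ) y u v) (fderiv ℝ φ y w) +
      G (φ y) (fderiv ℝ φ y v) (fderiv ℝ (fderiv ℝ φ) y u w) := by
  have hG' := (hG.hasFDerivAt (hφ.mapsTo hy)).comp y (hφ.hasFDerivAt hy)
  have hφ' (v : E) := (hφ.hasFDerivAt_fderiv hy).clm_apply (hasFDerivAt_const v y)
  have h1 := (((hφ.isMetricOn_pullback hG).hasFDerivAt hy).clm_apply
    (hasFDerivAt_const v y)).clm_apply (hasFDerivAt_const w y)
  have h2 := (hG'.clm_apply (hφ' v)).clm_apply (hφ' w)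
  have := DFunLike.congr_fun (h1.unique h2) u
  simp at this
  rw [this]
  abel

/-- Transformation of the Christoffel symbols under a change of coordinates. -/
theorem fderiv_christoffel_pullback (hy : y ∈ V) (v w : E) :
    fderiv ℝ φ y (christoffel (pullbackMetric φ G) y v w) =
      fderiv ℝ (fderiv ℝ φ) y v w +
        christoffel G (φ y) (fderiv ℝ φ y v) (fderiv ℝ φ y w) := by
  have hG' := hφ.isMetricOn_pullback hG
  rw [christoffel_eq_of_compatible (hG'.symm y hy) (hG'.isInvertible y hy) (fun v w =>
    (fderiv ℝ φ y).inverse (fderiv ℝ (fderiv ℝ φ) y v w +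
        christoffel G (φ y) (fderiv ℝ φ y v) (fderiv ℝ φ y w))),
    (hφ.isInvertible y hy).self_apply_inverse]
  · intro v w
    rw [hφ.fderiv_fderiv_symm hy, hG.christoffel_symm (hφ.mapsTo hy)]
  · intro u v w
    rw [hφ.fderiv_pullbackMetric_apply hG hy, hG.fderiv_apply (hφ.mapsTo hy)]
    simp only [pullbackMetric_apply, (hφ.isInvertible y hy).self_apply_inverse, map_add, add_apply]
    ring

/-- Naturality of the curvature. -/
theorem fderiv_curvature_pullback (hy : y ∈ V) (u v w : E) :
    fderiv ℝ φ y (curvature (pullbackMetric φ G) y v w u) =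
      curvature G (φ y) (fderiv ℝ φ y v) (fderiv ℝ φ y w) (fderiv ℝ φ y u) := by
  have hG' := hφ.isMetricOn_pullback hG
  have key (a v w : E) : fderiv ℝ (fderiv ℝ φ) y a (christoffel (pullbackMetric φ G) y v w) +
      fderiv ℝ φ y (fderiv ℝ (christoffel (pullbackMetric φ G)) y a v w) =
      fderiv ℝ (fderiv ℝ (fderiv ℝ φ)) y a v w +
      (fderiv ℝ (christoffel G) (φ y) (fderiv ℝ φ y a) (fderiv ℝ φ y v) (fderiv ℝ φ y w) +
      christoffel G (φ y) (fderiv ℝ (fderiv ℝ φ) y a v) (fderiv ℝ φ y w) +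
      christoffel G (φ y) (fderiv ℝ φ y v) (fderiv ℝ (fderiv ℝ φ) y a w)) := by
    have hφ' (v : E) := (hφ.hasFDerivAt_fderiv hy).clm_apply (hasFDerivAt_const v y)
    have h1 := (hφ.hasFDerivAt_fderiv hy).clm_apply (((hG'.hasFDerivAt_christoffel hy).clm_apply
      (hasFDerivAt_const v y)).clm_apply (hasFDerivAt_const w y))
    have h2 := (((hφ.hasFDerivAt_fderiv_fderiv hy).clm_apply (hasFDerivAt_const v y)).clm_apply
      (hasFDerivAt_const w y)).add
      ((((hG.hasFDerivAt_christoffel (hφ.mapsTo hy)).comp y (hφ.hasFDerivAt hy)).clm_apply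
        (hφ' v)).clm_apply (hφ' w))
    have h3 := h2.congr_of_eventuallyEq (Filter.eventually_of_mem (hφ.mem_nhds hy)
      fun z hz => hφ.fderiv_christoffel_pullback hG hz v w)
    have := DFunLike.congr_fun (h1.unique h3) a
    simp at this
    rw [add_comm, this]
    abel
  have k1 := eq_sub_of_add_eq' (key u v w)
  have k2 := eq_sub_of_add_eq' (key v u w)
  simp only [curvature_apply, map_add, map_sub, k1, k2, hφ.fderiv_christoffel_pullback hG hy]
  rw [hφ.fderiv_fderiv_fderiv_symm hy u v, hφ.fderiv_fderiv_symm hy u v]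
  abel

/-- Naturality of the Ricci tensor: it does not depend on the choice of coordinates. -/
theorem coordRicci_pullback (hy : y ∈ V) (v w : E) :
    coordRicci (pullbackMetric φ G) y v w =
      coordRicci G (φ y) (fderiv ℝ φ y v) (fderiv ℝ φ y w) := by
  obtain ⟨e, he⟩ := hφ.isInvertible y hy
  rw [coordRicci, coordRicci, ← LinearMap.trace_conj' _ e.toLinearEquiv]
  congr 1
  ext z
  obtain ⟨u, rfl⟩ := e.surjective z
  have := hφ.fderiv_curvature_pullback hG hy u v w
  rw [← he] at this ⊢
  simpa [LinearEquiv.conj_apply] using this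

end IsLocalDiffeoOn

end Pullback

/-! ### Schur's lemma in coordinates -/

section Schur

variable {E : Type*} [NormedAddCommGroup E] [NormedSpace ℝ E]

theorem trace_eq_sum_coord {ι : Type*} [Fintype ι] (b : Module.Basis ι ℝ E) (A : E →ₗ[ℝ] E) :
    LinearMap.trace ℝ E A = ∑ i, b.coord i (A (b i)) := by
  classical
  rw [LinearMap.trace_eq_matrix_trace ℝ b, Matrix.trace]
  simp [LinearMap.toMatrix_apply]

namespace IsMetricOn

variable [FiniteDimensional ℝ E] {G : E → E →L[ℝ] E →L[ℝ] ℝ} {U : Set E} (h : IsMetricOn G U)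
  {y : E}
include h

theorem hasFDerivAt_fderiv_christoffel (hy : y ∈ U) :
    HasFDerivAt (fderiv ℝ (christoffel G)) (fderiv ℝ (fderiv ℝ (christoffel G)) y) y :=
  (((h.contDiffOn_christoffel.fderiv_of_isOpen h.isOpen (m := ∞) (by simp)).contDiffAt
    (h.mem_nhds hy)).differentiableAt (by simp)).hasFDerivAt

theorem fderiv_fderiv_christoffel_symm (hy : y ∈ U) (a u : E) :
    fderiv ℝ (fderiv ℝ (christoffel G)) y a u = fderiv ℝ (fderiv ℝ (christoffel G)) y u a :=
  ((h.contDiffOn_christoffel.contDiffAt (h.mem_nhds hy)).isSymmSndFDerivAt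
    minSmoothness_two_le_infty).eq a u

theorem differentiableAt_curvature (hy : y ∈ U) (u v w : E) :
    DifferentiableAt ℝ (fun z => curvature G z v w u) y := by
  have h1 := (h.hasFDerivAt_christoffel hy).differentiableAt
  have h2 := (h.hasFDerivAt_fderiv_christoffel hy).differentiableAt
  simp only [curvature_apply]
  fun_prop

theorem differentiableAt_coordRicci (hy : y ∈ U) (v w : E) :
    DifferentiableAt ℝ (fun z => coordRicci G z v w) y := by
  simp only [coordRicci, trace_eq_sum_coord (Module.finBasis ℝ E)]
  refine DifferentiableAt.fun_sum fun i _ => ?_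
  exact (LinearMap.toContinuousLinearMap
    ((Module.finBasis ℝ E).coord i)).differentiableAt.comp y (h.differentiableAt_curvature hy _ _ _)

/-- The factor in `Ric(G) = l G` is differentiable, as a quotient of components of the two
tensors. -/
theorem differentiableAt_of_coordRicci_eq_smul (hy : y ∈ U) [Nontrivial E] {l : E → ℝ}
    (hl : ∀ z ∈ U, ∀ v w, coordRicci G z v w = l z * G z v w) : DifferentiableAt ℝ l y := by
  obtain ⟨v, hv⟩ := exists_ne (0 : E)
  obtain ⟨w, hw⟩ : ∃ w, G y v w ≠ 0 := by
    by_contra! hw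
    apply hv
    apply (h.isInvertible y hy).injective
    ext w
    simpa using hw w
  have hG : DifferentiableAt ℝ (fun z => G z v w) y := by
    have := h.differentiableAt hy
    fun_prop
  refine ((h.differentiableAt_coordRicci hy v w).fun_mul (hG.fun_inv hw)).congr_of_eventuallyEq ?_
  filter_upwards [h.mem_nhds hy, hG.continuousAt.eventually_ne hw] with z hz hz'
  simp only [hl z hz]
  field_simp

/-- Schur's lemma at the centre of normal coordinates, where the covariant derivative of a tensor
is the derivative of its coordinates: the second Bianchi identity is contracted twice. -/
theorem schur_of_christoffel_eq_zero (hy : y ∈ U) (hΓ : christoffel G y = 0)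
    (hdim : 2 < Module.finrank ℝ E) {l : E → ℝ}
    (hl : ∀ z ∈ U, ∀ v w, coordRicci G z v w = l z * G z v w) : fderiv ℝ l y = 0 := by
  have : Nontrivial E := Module.nontrivial_of_finrank_pos (R := ℝ) (by omega)
  have hld := (h.differentiableAt_of_coordRicci_eq_smul hy hl).hasFDerivAt
  have hDG : fderiv ℝ G y = 0 := by
    ext u v w
    simp [h.fderiv_apply hy, hΓ]
  set T : E → E → E → E → E := fun a u v w => fderiv ℝ (fun z => curvature G z v w u) y a
    with hT
  have hcurv (u v w : E) := (h.differentiableAt_curvature hy u v w).hasFDerivAt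
  have hTeq (a u v w : E) : T a u v w = fderiv ℝ (fderiv ℝ (christoffel G)) y a u v w -
      fderiv ℝ (fderiv ℝ (christoffel G)) y a v u w := by
    have hd (u v w : E) := (((h.hasFDerivAt_fderiv_christoffel hy).clm_apply
      (hasFDerivAt_const u y)).clm_apply (hasFDerivAt_const v y)).clm_apply (hasFDerivAt_const w y)
    have hg (v w : E) := ((h.hasFDerivAt_christoffel hy).clm_apply
      (hasFDerivAt_const v y)).clm_apply (hasFDerivAt_const w y)
    have hgg (u v w : E) := ((h.hasFDerivAt_christoffel hy).clm_apply
      (hasFDerivAt_const u y)).clm_apply (hg v w)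
    have := (((hd u v w).sub (hd v u w)).add (hgg u v w)).sub (hgg v u w)
    have := DFunLike.congr_fun ((hcurv u v w).unique this) a
    simp [hΓ] at this
    simpa [hT] using this
  -- `T a u v w` is `(∇_a R)(u, v) w` at `y`
  have hanti (a u v w : E) : T a u v w = - T a v u w := by
    rw [hTeq, hTeq]; abel
  have hbianchi (a u v w : E) : T a u v w + T u v a w + T v a u w = 0 := by
    simp only [hTeq]
    rw [h.fderiv_fderiv_christoffel_symm hy a u, h.fderiv_fderiv_christoffel_symm hy a v,
      h.fderiv_fderiv_christoffel_symm hy u v]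
    abel
  have hskew (a u v w z : E) : G y (T a u v w) z = - G y w (T a u v z) := by
    have h1 := ((h.hasFDerivAt hy).clm_apply (hcurv u v w)).clm_apply (hasFDerivAt_const z y)
    have h2 := (((h.hasFDerivAt hy).clm_apply (hasFDerivAt_const w y)).clm_apply (hcurv u v z)).neg
    have h3 := h2.congr_of_eventuallyEq
      (Filter.eventually_of_mem (h.mem_nhds hy) fun x hx => h.curvature_skew hx u v w z)
    have := DFunLike.congr_fun (h1.unique h3) a
    simpa [hDG, hT] using this
  set b := Module.finBasis ℝ E
  have htrace (a v w : E) : ∑ i, b.coord i (T a (b i) v w) = fderiv ℝ l y a * G y v w := by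
    have h1 : HasFDerivAt (fun z => ∑ i, b.coord i (curvature G z v w (b i)))
        (∑ i, (LinearMap.toContinuousLinearMap (b.coord i)).comp
          (fderiv ℝ (fun z => curvature G z v w (b i)) y)) y :=
      HasFDerivAt.fun_sum fun i _ =>
        (LinearMap.toContinuousLinearMap (b.coord i)).hasFDerivAt.comp y (hcurv (b i) v w)
    have h2 := hld.mul (((h.hasFDerivAt hy).clm_apply (hasFDerivAt_const v y)).clm_apply
      (hasFDerivAt_const w y))
    have h3 := h2.congr_of_eventuallyEq (f₁ := fun z => ∑ i, b.coord i (curvature G z v w (b i)))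
      (Filter.eventually_of_mem (h.mem_nhds hy) fun x hx => by
        simpa [coordRicci, trace_eq_sum_coord b] using hl x hx v w)
    have := DFunLike.congr_fun (h1.unique h3) a
    simp [hDG] at this
    simp [hT, this, mul_comm]
  -- `b' i` is the frame dual to `b i` with respect to the metric
  set b' : Fin (Module.finrank ℝ E) → E := fun i =>
    (G y).inverse (LinearMap.toContinuousLinearMap (b.coord i)) with hb'
  have hdual (i) (z : E) : G y (b' i) z = b.coord i z := by
    simp [hb', (h.isInvertible y hy).self_apply_inverse]
  have hdual' (i) (z : E) : G y z (b' i) = b.coord i z := by rw [h.symm y hy, hdual]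
  have hexp (a : E) : ∑ i, fderiv ℝ l y (b i) * b.coord i a = fderiv ℝ l y a := by
    conv_rhs => rw [← b.sum_repr a, map_sum]
    simp [mul_comm]
  ext a
  -- in the contracted Bianchi identity the three terms are `p dl(a)`, `- dl(a)` and `- dl(a)`
  have key : ∑ i, ∑ j, b.coord j (T a (b j) (b i) (b' i) + T (b j) (b i) a (b' i) +
      T (b i) a (b j) (b' i)) = 0 := by simp [hbianchi]
  have s1 : ∑ i, ∑ j, b.coord j (T a (b j) (b i) (b' i)) =
      Module.finrank ℝ E * fderiv ℝ l y a := by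
    simp only [htrace, hdual']
    simp
  have s3 : ∑ i, ∑ j, b.coord j (T (b i) a (b j) (b' i)) = - fderiv ℝ l y a := by
    simp only [hanti _ a, map_neg, Finset.sum_neg_distrib, htrace, hdual', hexp]
  have s2 : ∑ i, ∑ j, b.coord j (T (b j) (b i) a (b' i)) = - fderiv ℝ l y a := by
    -- the skew-adjointness of the curvature turns this divergence into a trace of `∇ Ric`
    have (i j : Fin (Module.finrank ℝ E)) :
        b.coord j (T (b j) (b i) a (b' i)) = - b.coord i (T (b j) (b i) a (b' j)) := by
      rw [← hdual', hskew, hdual]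
    simp only [this]
    rw [Finset.sum_comm]
    simp only [Finset.sum_neg_distrib, htrace, hdual', hexp]
  simp only [map_add, Finset.sum_add_distrib, s1, s2, s3] at key
  have hp : (2 : ℝ) < Module.finrank ℝ E := by exact_mod_cast hdim
  have : ((Module.finrank ℝ E : ℝ) - 2) * fderiv ℝ l y a = 0 := by linarith
  simpa [sub_ne_zero.2 hp.ne'] using this

/-- Coordinates whose Christoffel symbols vanish at the origin are obtained from the quadratic map
`z ↦ y + z - Γ(z, z) / 2`, whose second derivative cancels the Christoffel symbols `Γ` at `y`. -/
theorem exists_isLocalDiffeoOn_christoffel_eq_zero (hy : y ∈ U) :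
    ∃ (φ : E → E) (V : Set E), IsLocalDiffeoOn φ V U ∧ 0 ∈ V ∧ φ 0 = y ∧
      fderiv ℝ φ 0 = ContinuousLinearMap.id ℝ E ∧ christoffel (pullbackMetric φ G) 0 = 0 := by
  have := FiniteDimensional.complete ℝ E
  set C := christoffel G y with hC
  set φ : E → E := fun z => y + z - (1 / 2 : ℝ) • C z z with hφ
  have hd (z : E) : HasFDerivAt φ (ContinuousLinearMap.id ℝ E - C z) z := by
    have h1 := ((hasFDerivAt_id z).const_add y).sub
      (((C.hasFDerivAt (x := z)).clm_apply (hasFDerivAt_id z)).const_smul (1 / 2 : ℝ))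
    refine h1.congr_fderiv ?_
    ext u
    have : C u z = C z u := h.christoffel_symm hy u z
    simp only [id, sub_apply, smul_apply, add_apply, ContinuousLinearMap.comp_apply,
      ContinuousLinearMap.flip_apply, this, ContinuousLinearMap.id_apply]
    module
  have hd' : fderiv ℝ φ = fun z => ContinuousLinearMap.id ℝ E - C z := funext fun z => (hd z).fderiv
  have hsm : ContDiff ℝ ∞ φ := by
    have : ContDiff ℝ ∞ fun z => C z z := C.contDiff.clm_apply contDiff_id
    fun_prop
  set V : Set E := φ ⁻¹' U ∩ (fderiv ℝ φ) ⁻¹' (Set.range ((↑) : (E ≃L[ℝ] E) → E →L[ℝ] E))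
  have hV : IsOpen V := (h.isOpen.preimage hsm.continuous).inter
    (ContinuousLinearEquiv.isOpen.preimage (hsm.continuous_fderiv (by simp)))
  have hφV : IsLocalDiffeoOn φ V U := ⟨hV, hsm.contDiffOn, fun z hz => hz.1, fun z hz => hz.2⟩
  have h0 : φ 0 = y := by simp [hφ]
  have hd0 : fderiv ℝ φ 0 = ContinuousLinearMap.id ℝ E := by simp [hd']
  have h0V : (0 : E) ∈ V := ⟨by simpa [h0] using hy, by
    rw [Set.mem_preimage, hd0]; exact ⟨ContinuousLinearEquiv.refl ℝ E, rfl⟩⟩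
  refine ⟨φ, V, hφV, h0V, h0, hd0, ?_⟩
  ext v w
  have := hφV.fderiv_christoffel_pullback h h0V v w
  have hdd : fderiv ℝ (fderiv ℝ φ) 0 = - C := by
    rw [hd']
    exact (C.hasFDerivAt.const_sub _).fderiv
  rw [hdd, h0, hd0] at this
  simpa [← hC] using this

/-- Schur's lemma in coordinates. -/
theorem schur (hy : y ∈ U) (hdim : 2 < Module.finrank ℝ E) {l : E → ℝ}
    (hl : ∀ z ∈ U, ∀ v w, coordRicci G z v w = l z * G z v w) : fderiv ℝ l y = 0 := by
  have : Nontrivial E := Module.nontrivial_of_finrank_pos (R := ℝ) (by omega)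
  obtain ⟨φ, V, hφ, h0, hφ0, hd0, hΓ⟩ := h.exists_isLocalDiffeoOn_christoffel_eq_zero hy
  have h1 := (hφ.isMetricOn_pullback h).schur_of_christoffel_eq_zero h0 hΓ hdim (l := l ∘ φ)
    fun z hz v w => by
      rw [hφ.coordRicci_pullback h hz, hl _ (hφ.mapsTo hz)]
      rfl
  rw [fderiv_comp _ (by rw [hφ0]; exact h.differentiableAt_of_coordRicci_eq_smul hy hl)
    (hφ.hasFDerivAt h0).differentiableAt, hd0, hφ0] at h1
  simpa using h1

end IsMetricOn

end Schur

/-! ### Conformal change in coordinates -/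

section ConformalChange

variable {E : Type*} [NormedAddCommGroup E] [NormedSpace ℝ E]

/-- The positive Laplacian in coordinates. -/
def coordLaplacian (G : E → E →L[ℝ] E →L[ℝ] ℝ) (f : E → ℝ) (y : E) : ℝ :=
  - LinearMap.trace ℝ E ((G y).inverse.comp (coordHessian G f y) : E →L[ℝ] E)

/-- The squared norm of the differential in coordinates. -/
def coordGradNormSq (G : E → E →L[ℝ] E →L[ℝ] ℝ) (f : E → ℝ) (y : E) : ℝ :=
  fderiv ℝ f y ((G y).inverse (fderiv ℝ f y))

theorem trace_smulRight [FiniteDimensional ℝ E] (a : E →ₗ[ℝ] ℝ) (x : E) :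
    LinearMap.trace ℝ E (a.smulRight x) = a x := by
  rw [trace_eq_sum_coord (Module.finBasis ℝ E)]
  conv_rhs => rw [← (Module.finBasis ℝ E).sum_repr x, map_sum]
  simp [mul_comm]

namespace IsMetricOn

variable {G : E → E →L[ℝ] E →L[ℝ] ℝ} {U : Set E} (h : IsMetricOn G U)
  {f : E → ℝ} (hf : ContDiffOn ℝ ∞ f U) {y : E}

include h in
theorem smul {s : E → ℝ} (hs : ContDiffOn ℝ ∞ s U) (hs0 : ∀ y ∈ U, s y ≠ 0) :
    IsMetricOn (fun y => s y • G y) U where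
  isOpen := h.isOpen
  contDiffOn := hs.smul h.contDiffOn
  symm y hy v w := by simp [h.symm y hy v w]
  isInvertible y hy := by
    obtain ⟨e, he⟩ := h.isInvertible y hy
    refine ⟨e.trans (ContinuousLinearEquiv.smulLeft (Units.mk0 (s y) (hs0 y hy))), ?_⟩
    rw [← he]
    rfl

include h hf

theorem differentiableAt_of_contDiffOn (hy : y ∈ U) : DifferentiableAt ℝ f y :=
  (hf.contDiffAt (h.mem_nhds hy)).differentiableAt (by simp)

theorem contDiffOn_fderiv_fun : ContDiffOn ℝ ∞ (fderiv ℝ f) U :=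
  hf.fderiv_of_isOpen h.isOpen (by simp)

theorem hasFDerivAt_fderiv_fun (hy : y ∈ U) :
    HasFDerivAt (fderiv ℝ f) (fderiv ℝ (fderiv ℝ f) y) y :=
  (((h.contDiffOn_fderiv_fun hf).contDiffAt (h.mem_nhds hy)).differentiableAt (by simp)).hasFDerivAt

theorem isMetricOn_exp_smul : IsMetricOn (fun y => Real.exp (2 * f y) • G y) U :=
  h.smul (contDiffOn_const.mul hf).exp fun _ _ => (Real.exp_pos _).ne'

theorem fderiv_exp_smul_apply (hy : y ∈ U) (u v w : E) :
    fderiv ℝ (fun y => Real.exp (2 * f y) • G y) y u v w =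
      Real.exp (2 * f y) * (2 * fderiv ℝ f y u * G y v w + fderiv ℝ G y u v w) := by
  have h1 := (((h.differentiableAt_of_contDiffOn hf hy).hasFDerivAt.const_mul 2).exp).smul
    (h.hasFDerivAt hy)
  have : fderiv ℝ (fun y => Real.exp (2 * f y) • G y) y = _ := h1.fderiv
  rw [this]
  simp
  ring

/-- The Levi-Civita connection of a conformal metric. -/
theorem christoffel_exp_smul (hy : y ∈ U) (v w : E) :
    christoffel (fun y => Real.exp (2 * f y) • G y) y v w = christoffel G y v w +
      (fderiv ℝ f y v • w + fderiv ℝ f y w • v - G y v w • (G y).inverse (fderiv ℝ f y)) := by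
  have hc := h.isMetricOn_exp_smul hf
  have hA (z : E) : G y ((G y).inverse (fderiv ℝ f y)) z = fderiv ℝ f y z := by
    rw [(h.isInvertible y hy).self_apply_inverse]
  refine christoffel_eq_of_compatible (hc.symm y hy) (hc.isInvertible y hy) (fun v w =>
    christoffel G y v w + (fderiv ℝ f y v • w + fderiv ℝ f y w • v -
      G y v w • (G y).inverse (fderiv ℝ f y))) ?_ ?_ v w
  · intro v w
    rw [h.christoffel_symm hy, h.symm y hy v w]
    abel
  · intro u v w
    rw [h.fderiv_exp_smul_apply hf hy, h.fderiv_apply hy]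
    simp only [smul_apply, map_add, map_sub, add_apply, sub_apply, map_smul, smul_eq_mul, hA,
      h.symm y hy v ((G y).inverse (fderiv ℝ f y)), h.symm y hy v u]
    ring

variable [FiniteDimensional ℝ E]

theorem hasFDerivAt_inverse_fderiv (hy : y ∈ U) :
    HasFDerivAt (fun y => (G y).inverse (fderiv ℝ f y))
      (fderiv ℝ (fun y => (G y).inverse (fderiv ℝ f y)) y) y :=
  (((h.contDiffOn_inverse.clm_apply (h.contDiffOn_fderiv_fun hf)).contDiffAt
    (h.mem_nhds hy)).differentiableAt (by simp)).hasFDerivAt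

/-- The covariant derivative of the gradient is the Hessian with an index raised. -/
theorem fderiv_inverse_fderiv_apply (hy : y ∈ U) (u : E) :
    fderiv ℝ (fun y => (G y).inverse (fderiv ℝ f y)) y u +
      christoffel G y u ((G y).inverse (fderiv ℝ f y)) =
      (G y).inverse (coordHessian G f y u) := by
  have hA (y : E) (hy : y ∈ U) (z : E) :
      G y ((G y).inverse (fderiv ℝ f y)) z = fderiv ℝ f y z := by
    rw [(h.isInvertible y hy).self_apply_inverse]
  rw [eq_comm, (h.isInvertible y hy).inverse_apply_eq]
  ext z
  have h1 := ((h.hasFDerivAt hy).clm_apply (h.hasFDerivAt_inverse_fderiv hf hy)).clm_apply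
    (hasFDerivAt_const z y)
  have h2 := (h.hasFDerivAt_fderiv_fun hf hy).clm_apply (hasFDerivAt_const z y)
  have h3 := h2.congr_of_eventuallyEq
    (Filter.eventually_of_mem (h.mem_nhds hy) fun x hx => hA x hx z)
  have := DFunLike.congr_fun (h1.unique h3) u
  simp [h.fderiv_apply hy, hA y hy] at this
  rw [coordHessian_apply, ← this, map_add, add_apply]
  ring

/-- The curvature of a conformal metric. -/
theorem curvature_exp_smul (hy : y ∈ U) (u v w : E) :
    curvature (fun y => Real.exp (2 * f y) • G y) y v w u = curvature G y v w u +
      (coordHessian G f y u w • v - coordHessian G f y v w • u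
        - G y v w • (G y).inverse (coordHessian G f y u)
        + G y w u • (G y).inverse (coordHessian G f y v)
        + (fderiv ℝ f y v * fderiv ℝ f y w) • u - fderiv ℝ f y w • fderiv ℝ f y u • v
        - coordGradNormSq G f y • (G y v w • u - G y w u • v)
        + G y v w • fderiv ℝ f y u • (G y).inverse (fderiv ℝ f y)
        - fderiv ℝ f y v • G y w u • (G y).inverse (fderiv ℝ f y)) := by
  have hc := h.isMetricOn_exp_smul hf
  have hA (z : E) : G y z ((G y).inverse (fderiv ℝ f y)) = fderiv ℝ f y z := by
    rw [h.symm y hy, (h.isInvertible y hy).self_apply_inverse]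
  have hder (u v w : E) : fderiv ℝ (christoffel (fun y => Real.exp (2 * f y) • G y)) y u v w =
      fderiv ℝ (christoffel G) y u v w + (fderiv ℝ (fderiv ℝ f) y u v • w +
        fderiv ℝ (fderiv ℝ f) y u w • v
        - fderiv ℝ G y u v w • (G y).inverse (fderiv ℝ f y)
        - G y v w • fderiv ℝ (fun y => (G y).inverse (fderiv ℝ f y)) y u) := by
    have h1 := ((hc.hasFDerivAt_christoffel hy).clm_apply (hasFDerivAt_const v y)).clm_apply
      (hasFDerivAt_const w y)
    have hdf (v : E) := (h.hasFDerivAt_fderiv_fun hf hy).clm_apply (hasFDerivAt_const v y)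
    have h2 := (((h.hasFDerivAt_christoffel hy).clm_apply (hasFDerivAt_const v y)).clm_apply
      (hasFDerivAt_const w y)).add ((((hdf v).smul_const w).add ((hdf w).smul_const v)).sub
      ((((h.hasFDerivAt hy).clm_apply (hasFDerivAt_const v y)).clm_apply
        (hasFDerivAt_const w y)).smul (h.hasFDerivAt_inverse_fderiv hf hy)))
    have h3 := h2.congr_of_eventuallyEq
      (Filter.eventually_of_mem (h.mem_nhds hy) fun x hx => h.christoffel_exp_smul hf hx v w)
    have := DFunLike.congr_fun (h1.unique h3) u
    simp at this
    rw [this]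
    abel
  have hsymm : fderiv ℝ (fderiv ℝ f) y u v = fderiv ℝ (fderiv ℝ f) y v u :=
    ((hf.contDiffAt (h.mem_nhds hy)).isSymmSndFDerivAt minSmoothness_two_le_infty).eq u v
  rw [← h.fderiv_inverse_fderiv_apply hf hy u, ← h.fderiv_inverse_fderiv_apply hf hy v]
  simp only [curvature_apply, hder, h.christoffel_exp_smul hf hy, h.fderiv_apply hy,
    coordHessian_apply, map_add, map_sub, map_smul, smul_eq_mul, hA, coordGradNormSq,
    hsymm, h.symm y hy w u, h.symm y hy v u, h.christoffel_symm hy v u,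
    h.symm y hy v (christoffel G y u w)]
  module

/-- The Ricci tensor of a conformal metric `exp(2f) G`. -/
theorem coordRicci_exp_smul (hy : y ∈ U) (v w : E) :
    coordRicci (fun y => Real.exp (2 * f y) • G y) y v w = coordRicci G y v w
      - ((Module.finrank ℝ E : ℝ) - 2) *
        (coordHessian G f y v w - fderiv ℝ f y v * fderiv ℝ f y w)
      + (coordLaplacian G f y - ((Module.finrank ℝ E : ℝ) - 2) * coordGradNormSq G f y) *
        G y v w := by
  have key : (curvature (fun y => Real.exp (2 * f y) • G y) y v w : E →ₗ[ℝ] E) =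
      (curvature G y v w : E →ₗ[ℝ] E) +
      (((coordHessian G f y).flip w : E →ₗ[ℝ] ℝ).smulRight v
        - coordHessian G f y v w • LinearMap.id
        - G y v w • (((G y).inverse.comp (coordHessian G f y) : E →L[ℝ] E) : E →ₗ[ℝ] E)
        + (G y w : E →ₗ[ℝ] ℝ).smulRight ((G y).inverse (coordHessian G f y v))
        + (fderiv ℝ f y v * fderiv ℝ f y w) • LinearMap.id
        - fderiv ℝ f y w • (fderiv ℝ f y : E →ₗ[ℝ] ℝ).smulRight v
        - coordGradNormSq G f y • (G y v w • LinearMap.id - (G y w : E →ₗ[ℝ] ℝ).smulRight v)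
        + G y v w • (fderiv ℝ f y : E →ₗ[ℝ] ℝ).smulRight ((G y).inverse (fderiv ℝ f y))
        - fderiv ℝ f y v • (G y w : E →ₗ[ℝ] ℝ).smulRight ((G y).inverse (fderiv ℝ f y))) := by
    ext u
    exact h.curvature_exp_smul hf hy u v w
  have hH : G y w ((G y).inverse (coordHessian G f y v)) = coordHessian G f y v w := by
    rw [h.symm y hy, (h.isInvertible y hy).self_apply_inverse]
  have hA : G y w ((G y).inverse (fderiv ℝ f y)) = fderiv ℝ f y w := by
    rw [h.symm y hy, (h.isInvertible y hy).self_apply_inverse]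
  rw [coordRicci, coordRicci, key]
  simp only [map_add, map_sub, map_smul, trace_smulRight, LinearMap.trace_id, smul_eq_mul,
    ContinuousLinearMap.coe_coe, hH, hA, ContinuousLinearMap.flip_apply]
  rw [h.symm y hy w v, coordLaplacian]
  rw [show fderiv ℝ f y ((G y).inverse (fderiv ℝ f y)) = coordGradNormSq G f y from rfl]
  ring

omit h hf in
/-- The Ricci tensor of the conformal metric `r⁻² G`. -/
theorem coordRicci_conformal (h : IsMetricOn G U) {r : E → ℝ} (hr : ContDiffOn ℝ ∞ r U)
    (hpos : ∀ y, 0 < r y) (hy : y ∈ U) (v w : E) :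
    coordRicci (fun y => ((r y) ^ 2)⁻¹ • G y) y v w = coordRicci G y v w
      + ((Module.finrank ℝ E : ℝ) - 2) * (coordHessian G r y v w / r y)
      - (coordLaplacian G r y / r y +
        ((Module.finrank ℝ E : ℝ) - 1) * coordGradNormSq G r y / r y ^ 2) * G y v w := by
  have hexp : (fun y => ((r y) ^ 2)⁻¹ • G y) = fun y => Real.exp (2 * (-Real.log (r y))) • G y := by
    ext1 z
    rw [show 2 * (-Real.log (r z)) = -(Real.log (r z) + Real.log (r z)) by ring, Real.exp_neg,
      Real.exp_add, Real.exp_log (hpos z), sq]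
  have hf : ContDiffOn ℝ ∞ (fun y => -Real.log (r y)) U := (hr.log fun z _ => (hpos z).ne').neg
  have hdf (z : E) (hz : z ∈ U) : fderiv ℝ (fun y => -Real.log (r y)) z =
      (-(r z)⁻¹) • fderiv ℝ r z := by
    have := ((h.differentiableAt_of_contDiffOn hr hz).hasFDerivAt.log (hpos z).ne').neg
    rw [neg_smul]
    exact this.fderiv
  have hddf : fderiv ℝ (fderiv ℝ (fun y => -Real.log (r y))) y =
      (-(r y)⁻¹) • fderiv ℝ (fderiv ℝ r) y +
        (((r y) ^ 2)⁻¹ • fderiv ℝ r y).smulRight (fderiv ℝ r y) := by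
    have h1 : HasFDerivAt (fun z => -(r z)⁻¹) (((r y) ^ 2)⁻¹ • fderiv ℝ r y) y := by
      exact ((hasDerivAt_inv (hpos y).ne').comp_hasFDerivAt y
        (h.differentiableAt_of_contDiffOn hr hy).hasFDerivAt).neg.congr_fderiv (by simp)
    have h2 := h1.smul (h.hasFDerivAt_fderiv_fun hr hy)
    exact (h2.congr_of_eventuallyEq
      (Filter.eventually_of_mem (h.mem_nhds hy) fun z hz => hdf z hz)).fderiv
  have hHess : coordHessian G (fun y => -Real.log (r y)) y = (-(r y)⁻¹) • coordHessian G r y +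
        (((r y) ^ 2)⁻¹ • fderiv ℝ r y).smulRight (fderiv ℝ r y) := by
    ext v w
    rw [coordHessian_apply, hddf, hdf y hy]
    simp only [add_apply, smul_apply, coordHessian_apply, smul_eq_mul]
    ring
  have hlap : coordLaplacian G (fun y => -Real.log (r y)) y = -(r y)⁻¹ * coordLaplacian G r y -
      ((r y) ^ 2)⁻¹ * coordGradNormSq G r y := by
    have : ((G y).inverse.comp ((-(r y)⁻¹) • coordHessian G r y +
        (((r y) ^ 2)⁻¹ • fderiv ℝ r y).smulRight (fderiv ℝ r y)) : E →ₗ[ℝ] E) =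
        (-(r y)⁻¹) • ((G y).inverse.comp (coordHessian G r y) : E →ₗ[ℝ] E) +
        ((r y) ^ 2)⁻¹ • (fderiv ℝ r y : E →ₗ[ℝ] ℝ).smulRight
          ((G y).inverse (fderiv ℝ r y)) := by
      ext u
      simp [smul_smul]
    rw [coordLaplacian, hHess, this, map_add, map_smul, map_smul, trace_smulRight, coordLaplacian,
      coordGradNormSq]
    simp only [smul_eq_mul, ContinuousLinearMap.coe_coe]
    ring
  have hgrad : coordGradNormSq G (fun y => -Real.log (r y)) y =
      ((r y) ^ 2)⁻¹ * coordGradNormSq G r y := by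
    rw [coordGradNormSq, hdf y hy, coordGradNormSq]
    simp
    ring
  rw [hexp, h.coordRicci_exp_smul hf hy, hHess, hlap, hgrad, hdf y hy]
  have := (hpos y).ne'
  simp only [add_apply, smul_apply, ContinuousLinearMap.smulRight_apply, smul_eq_mul]
  field_simp
  ring

end IsMetricOn

end ConformalChange

/-! ### Products in coordinates -/

section Germs

variable {E : Type*} [NormedAddCommGroup E] [NormedSpace ℝ E]
  {G G' : E → E →L[ℝ] E →L[ℝ] ℝ} {U : Set E} {y : E}

theorem christoffel_congr (h : G =ᶠ[nhds y] G') : christoffel G =ᶠ[nhds y] christoffel G' := by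
  filter_upwards [h, h.fderiv (𝕜 := ℝ)] with z hz hz'
  rw [christoffel, christoffel, hz, hz']

/-- The Ricci tensor is a local invariant of the metric. -/
theorem coordRicci_congr (h : G =ᶠ[nhds y] G') (v w : E) :
    coordRicci G y v w = coordRicci G' y v w := by
  have hΓ := christoffel_congr h
  rw [coordRicci, coordRicci, curvature, curvature, hΓ.fderiv_eq, hΓ.self_of_nhds]

theorem coordHessian_congr (h : G =ᶠ[nhds y] G') (f : E → ℝ) :
    coordHessian G f y = coordHessian G' f y := by
  rw [coordHessian, coordHessian, (christoffel_congr h).self_of_nhds]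

theorem IsMetricOn.congr (h : IsMetricOn G' U) (hG : ∀ y ∈ U, G y = G' y) : IsMetricOn G U where
  isOpen := h.isOpen
  contDiffOn := h.contDiffOn.congr hG
  symm y hy := by rw [hG y hy]; exact h.symm y hy
  isInvertible y hy := by rw [hG y hy]; exact h.isInvertible y hy

end Germs

section ProductCoordinates

variable {E : Type*} [NormedAddCommGroup E] [NormedSpace ℝ E]
  {E' : Type*} [NormedAddCommGroup E'] [NormedSpace ℝ E']

/-- The product of two metrics in coordinates. -/
def coordProduct (G : E → E →L[ℝ] E →L[ℝ] ℝ) (G' : E' → E' →L[ℝ] E' →L[ℝ] ℝ) (z : E × E') :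
    E × E' →L[ℝ] E × E' →L[ℝ] ℝ :=
  pullbackForm (G z.1) (ContinuousLinearMap.fst ℝ E E') +
    pullbackForm (G' z.2) (ContinuousLinearMap.snd ℝ E E')

theorem coordProduct_apply (G : E → E →L[ℝ] E →L[ℝ] ℝ) (G' : E' → E' →L[ℝ] E' →L[ℝ] ℝ)
    (z v w : E × E') : coordProduct G G' z v w = G z.1 v.1 w.1 + G' z.2 v.2 w.2 := rfl

namespace IsMetricOn

variable [FiniteDimensional ℝ E] [FiniteDimensional ℝ E']
  {G : E → E →L[ℝ] E →L[ℝ] ℝ} {U : Set E} (h : IsMetricOn G U)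
  {G' : E' → E' →L[ℝ] E' →L[ℝ] ℝ} {U' : Set E'} (h' : IsMetricOn G' U')
  {z : E × E'}
include h h'

theorem prod : IsMetricOn (coordProduct G G') (U ×ˢ U') where
  isOpen := h.isOpen.prod h'.isOpen
  contDiffOn := by
    have := FiniteDimensional.complete ℝ E
    have := FiniteDimensional.complete ℝ E'
    rw [contDiffOn_clm_apply]
    intro v
    rw [contDiffOn_clm_apply]
    intro w
    simp only [coordProduct_apply]
    exact (((h.contDiffOn.comp contDiff_fst.contDiffOn fun z hz => hz.1).clm_apply
      contDiffOn_const).clm_apply contDiffOn_const).add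
      (((h'.contDiffOn.comp contDiff_snd.contDiffOn fun z hz => hz.2).clm_apply
      contDiffOn_const).clm_apply contDiffOn_const)
  symm z hz v w := by
    rw [coordProduct_apply, coordProduct_apply, h.symm _ hz.1, h'.symm _ hz.2]
  isInvertible z hz := by
    apply isInvertible_of_nondegenerate
    intro v hv
    apply Prod.ext
    · apply (h.isInvertible _ hz.1).injective
      ext w
      simpa [coordProduct_apply] using hv (w, 0)
    · apply (h'.isInvertible _ hz.2).injective
      ext w
      simpa [coordProduct_apply] using hv (0, w)

theorem fderiv_coordProduct_apply (hz : z ∈ U ×ˢ U') (u v w : E × E') :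
    fderiv ℝ (coordProduct G G') z u v w =
      fderiv ℝ G z.1 u.1 v.1 w.1 + fderiv ℝ G' z.2 u.2 v.2 w.2 := by
  have h1 := (((h.prod h').hasFDerivAt hz).clm_apply (hasFDerivAt_const v z)).clm_apply
    (hasFDerivAt_const w z)
  have h2 := ((((h.hasFDerivAt hz.1).comp z hasFDerivAt_fst).clm_apply
    (hasFDerivAt_const v.1 z)).clm_apply (hasFDerivAt_const w.1 z)).add
    ((((h'.hasFDerivAt hz.2).comp z hasFDerivAt_snd).clm_apply
    (hasFDerivAt_const v.2 z)).clm_apply (hasFDerivAt_const w.2 z))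
  simpa using DFunLike.congr_fun (h1.unique h2) u

theorem christoffel_coordProduct (hz : z ∈ U ×ˢ U') (v w : E × E') :
    christoffel (coordProduct G G') z v w =
      (christoffel G z.1 v.1 w.1, christoffel G' z.2 v.2 w.2) := by
  refine christoffel_eq_of_compatible ((h.prod h').symm z hz) ((h.prod h').isInvertible z hz)
    (fun v w => (christoffel G z.1 v.1 w.1, christoffel G' z.2 v.2 w.2)) ?_ ?_ v w
  · intro v w
    rw [h.christoffel_symm hz.1, h'.christoffel_symm hz.2]
  · intro u v w
    rw [h.fderiv_coordProduct_apply h' hz, h.fderiv_apply hz.1, h'.fderiv_apply hz.2]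
    simp only [coordProduct_apply]
    ring

theorem curvature_coordProduct (hz : z ∈ U ×ˢ U') (u v w : E × E') :
    curvature (coordProduct G G') z v w u =
      (curvature G z.1 v.1 w.1 u.1, curvature G' z.2 v.2 w.2 u.2) := by
  have hder (u v w : E × E') : fderiv ℝ (christoffel (coordProduct G G')) z u v w =
      (fderiv ℝ (christoffel G) z.1 u.1 v.1 w.1,
        fderiv ℝ (christoffel G') z.2 u.2 v.2 w.2) := by
    have h1 := (((h.prod h').hasFDerivAt_christoffel hz).clm_apply
      (hasFDerivAt_const v z)).clm_apply (hasFDerivAt_const w z)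
    have h2 := ((((h.hasFDerivAt_christoffel hz.1).comp z hasFDerivAt_fst).clm_apply
      (hasFDerivAt_const v.1 z)).clm_apply (hasFDerivAt_const w.1 z)).prodMk
      ((((h'.hasFDerivAt_christoffel hz.2).comp z hasFDerivAt_snd).clm_apply
      (hasFDerivAt_const v.2 z)).clm_apply (hasFDerivAt_const w.2 z))
    have h3 := h2.congr_of_eventuallyEq (Filter.eventually_of_mem ((h.prod h').mem_nhds hz)
      fun x hx => h.christoffel_coordProduct h' hx v w)
    simpa using DFunLike.congr_fun (h1.unique h3) u
  simp only [curvature_apply, hder, h.christoffel_coordProduct h' hz]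
  rfl

theorem coordRicci_coordProduct (hz : z ∈ U ×ˢ U') (v w : E × E') :
    coordRicci (coordProduct G G') z v w =
      coordRicci G z.1 v.1 w.1 + coordRicci G' z.2 v.2 w.2 := by
  rw [coordRicci, coordRicci, coordRicci, ← LinearMap.trace_prodMap']
  congr 1
  refine LinearMap.ext fun u => ?_
  exact h.curvature_coordProduct h' hz u v w

/-- Raising the index of a covector pulled back from the first factor. -/
theorem inverse_coordProduct_comp_fst (hz : z ∈ U ×ˢ U') (a : E →L[ℝ] ℝ) :
    (coordProduct G G' z).inverse (a.comp (ContinuousLinearMap.fst ℝ E E')) =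
      ((G z.1).inverse a, 0) := by
  rw [((h.prod h').isInvertible z hz).inverse_apply_eq]
  ext w
  · simp [coordProduct_apply, (h.isInvertible _ hz.1).self_apply_inverse]
  · simp [coordProduct_apply]

variable {r : E → ℝ} (hr : ContDiffOn ℝ ∞ r U)
include hr

omit [FiniteDimensional ℝ E] [FiniteDimensional ℝ E'] h' in
theorem fderiv_comp_fst (hz : z.1 ∈ U) :
    fderiv ℝ (fun x : E × E' => r x.1) z =
      (fderiv ℝ r z.1).comp (ContinuousLinearMap.fst ℝ E E') :=
  ((h.differentiableAt_of_contDiffOn hr hz).hasFDerivAt.comp z hasFDerivAt_fst).fderiv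

theorem coordHessian_coordProduct (hz : z ∈ U ×ˢ U') (v w : E × E') :
    coordHessian (coordProduct G G') (fun x : E × E' => r x.1) z v w =
      coordHessian G r z.1 v.1 w.1 := by
  have h1 : HasFDerivAt (fderiv ℝ (fun x : E × E' => r x.1))
      (fderiv ℝ (fderiv ℝ (fun x : E × E' => r x.1)) z) z :=
    (h.prod h').hasFDerivAt_fderiv_fun
      (f := fun x : E × E' => r x.1) (hr.comp contDiff_fst.contDiffOn fun z hz => hz.1) hz
  have h2 := ((h.hasFDerivAt_fderiv_fun hr hz.1).comp z hasFDerivAt_fst).clm_apply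
    (hasFDerivAt_const w.1 z)
  have h3 := h2.congr_of_eventuallyEq (f₁ := fun x => fderiv ℝ (fun x : E × E' => r x.1) x w)
    (Filter.eventually_of_mem ((h.prod h').mem_nhds hz)
      fun x hx => by simp only [h.fderiv_comp_fst hr (Set.mem_prod.1 hx).1]; rfl)
  have h4 := DFunLike.congr_fun ((h1.clm_apply (hasFDerivAt_const w z)).unique h3) v
  simp at h4
  rw [coordHessian_apply, h4, h.christoffel_coordProduct h' hz, h.fderiv_comp_fst hr hz.1]
  rfl

theorem coordGradNormSq_coordProduct (hz : z ∈ U ×ˢ U') :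
    coordGradNormSq (coordProduct G G') (fun x : E × E' => r x.1) z =
      coordGradNormSq G r z.1 := by
  rw [coordGradNormSq, h.fderiv_comp_fst hr hz.1, h.inverse_coordProduct_comp_fst h' hz]
  rfl

theorem coordLaplacian_coordProduct (hz : z ∈ U ×ˢ U') :
    coordLaplacian (coordProduct G G') (fun x : E × E' => r x.1) z = coordLaplacian G r z.1 := by
  have key : (((coordProduct G G' z).inverse.comp
      (coordHessian (coordProduct G G') (fun x : E × E' => r x.1) z) : E × E' →L[ℝ] E × E') :
        E × E' →ₗ[ℝ] E × E') =
      LinearMap.prodMap (((G z.1).inverse.comp (coordHessian G r z.1) : E →L[ℝ] E) : E →ₗ[ℝ] E)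
        (0 : E' →ₗ[ℝ] E') := by
    refine LinearMap.ext fun u => ?_
    have : coordHessian (coordProduct G G') (fun x : E × E' => r x.1) z u =
        (coordHessian G r z.1 u.1).comp (ContinuousLinearMap.fst ℝ E E') := by
      refine ContinuousLinearMap.ext fun w => ?_
      exact h.coordHessian_coordProduct h' hr hz u w
    rw [ContinuousLinearMap.coe_coe, ContinuousLinearMap.comp_apply, this,
      h.inverse_coordProduct_comp_fst h' hz]
    rfl
  rw [coordLaplacian, coordLaplacian, key, LinearMap.trace_prodMap', map_zero, add_zero]

end IsMetricOn
end ProductCoordinates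

/-! ### From charts to manifolds -/

section Charts

theorem isInvertible_of_comp {E : Type*} [NormedAddCommGroup E] [NormedSpace ℝ E]
    {A B : E →L[ℝ] E} (hA : A.IsInvertible) (hAB : (A.comp B).IsInvertible) : B.IsInvertible := by
  have := hA.inverse.comp hAB
  rwa [← ContinuousLinearMap.comp_assoc, hA.inverse_comp_self, ContinuousLinearMap.id_comp] at this

variable {E : Type*} [NormedAddCommGroup E] [NormedSpace ℝ E]
  {H : Type*} [TopologicalSpace H] {I : ModelWithCorners ℝ E H} [I.Boundaryless]
  {M : Type*} [TopologicalSpace M] [ChartedSpace H M] [IsManifold I ∞ M]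

omit [I.Boundaryless] [IsManifold I ∞ M] in
/-- Rewriting the base point of a field of bilinear forms, where all tangent spaces are the model
space. -/
theorem bilinField_congr {F : Type*} [NormedAddCommGroup F] [NormedSpace ℝ F] (g : BilinField I M)
    {p q : M} (hpq : p = q) {A B : F →L[ℝ] E} (hAB : A = B) (v w : F) :
    (g p : E →L[ℝ] E →L[ℝ] ℝ) (A v) (A w) = (g q : E →L[ℝ] E →L[ℝ] ℝ) (B v) (B w) := by
  subst hpq hAB
  rfl

theorem mdifferentiableAt_extChartAt_symm (x : M) {y : E} (hy : y ∈ (extChartAt I x).target) :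
    MDifferentiableAt 𝓘(ℝ, E) I (extChartAt I x).symm y := by
  have : IsManifold I 1 M := IsManifold.of_le (n := ∞) (by simp)
  exact ((contMDiffOn_extChartAt_symm (n := 1) x).contMDiffAt
    ((isOpen_extChartAt_target x).mem_nhds hy)).mdifferentiableAt (by simp)

theorem isInvertible_mfderiv_extChartAt_symm (x : M) {y : E} (hy : y ∈ (extChartAt I x).target) :
    (mfderiv 𝓘(ℝ, E) I (extChartAt I x).symm y).IsInvertible := by
  have : IsManifold I 1 M := IsManifold.of_le (n := ∞) (by simp)
  have := isInvertible_mfderivWithin_extChartAt_symm (I := I) hy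
  rwa [I.range_eq_univ, mfderivWithin_univ] at this

theorem mfderiv_extChartAt_symm_self (x : M) :
    (mfderiv 𝓘(ℝ, E) I (extChartAt I x).symm (extChartAt I x x) : E →L[ℝ] E) =
      ContinuousLinearMap.id ℝ E := by
  have : IsManifold I 1 M := IsManifold.of_le (n := ∞) (by simp)
  have := mfderivWithin_range_extChartAt_symm (I := I) (x := x)
  rwa [I.range_eq_univ, mfderivWithin_univ] at this

/-- The chart around `x` identifies `T_x M` with the model space by the identity, so that tensors at
`x` agree with their coordinate expressions. -/
theorem coordMetric_self (g : BilinField I M) (x : M) :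
    coordMetric g x (extChartAt I x x) = (g x : E →L[ℝ] E →L[ℝ] ℝ) := by
  ext v w
  exact bilinField_congr (F := E) g (extChartAt_to_inv x) (mfderiv_extChartAt_symm_self x) v w

omit [I.Boundaryless] in
theorem ricci_eq (g : BilinField I M) (x : M) (v w : E) :
    ricci g x v w = coordRicci (coordMetric g x) (extChartAt I x x) v w := by
  have : IsManifold I 1 M := IsManifold.of_le (n := ∞) (by simp)
  have hself : (mfderiv I 𝓘(ℝ, E) (extChartAt I x) x : E →L[ℝ] E) = ContinuousLinearMap.id ℝ E :=
    mfderiv_extChartAt_self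
  exact congrArg₂ (coordRicci (coordMetric g x) (extChartAt I x x))
    (DFunLike.congr_fun hself v) (DFunLike.congr_fun hself w)

omit [I.Boundaryless] in
theorem hessian_eq (g : BilinField I M) (f : M → ℝ) (x : M) :
    (hessian g f x : E →L[ℝ] E →L[ℝ] ℝ) =
      coordHessian (coordMetric g x) (f ∘ (extChartAt I x).symm) (extChartAt I x x) := by
  have : IsManifold I 1 M := IsManifold.of_le (n := ∞) (by simp)
  rw [hessian, mfderiv_extChartAt_self]
  rfl

omit [IsManifold I ∞ M] in
theorem differential_eq {f : M → ℝ} (hf : ContMDiff I 𝓘(ℝ, ℝ) ∞ f) (x : M) :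
    (differential I f x : E →L[ℝ] ℝ) =
      fderiv ℝ (f ∘ (extChartAt I x).symm) (extChartAt I x x) := by
  rw [differential, (hf.mdifferentiableAt (by simp)).mfderiv, writtenInExtChartAt, I.range_eq_univ,
    fderivWithin_univ]
  rfl

theorem laplacian_eq (g : BilinField I M) (f : M → ℝ) (x : M) :
    laplacian g f x =
      coordLaplacian (coordMetric g x) (f ∘ (extChartAt I x).symm) (extChartAt I x x) := by
  rw [coordLaplacian, ← hessian_eq, coordMetric_self]
  rfl

theorem gradNormSq_eq (g : BilinField I M) {f : M → ℝ} (hf : ContMDiff I 𝓘(ℝ, ℝ) ∞ f) (x : M) :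
    gradNormSq g f x =
      coordGradNormSq (coordMetric g x) (f ∘ (extChartAt I x).symm) (extChartAt I x x) := by
  rw [coordGradNormSq, ← differential_eq hf, coordMetric_self]
  rfl

omit [I.Boundaryless] in
theorem contDiffOn_comp_extChartAt_symm {f : M → ℝ} (hf : ContMDiff I 𝓘(ℝ, ℝ) ∞ f) (x : M) :
    ContDiffOn ℝ ∞ (f ∘ (extChartAt I x).symm) (extChartAt I x).target :=
  (hf.comp_contMDiffOn (contMDiffOn_extChartAt_symm x)).contDiffOn

omit [I.Boundaryless] [IsManifold I ∞ M] in
theorem mem_coordChange_source {x x' : M} {y : E} :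
    y ∈ ((extChartAt I x).symm.trans (extChartAt I x')).source ↔
      y ∈ (extChartAt I x).target ∧ (extChartAt I x).symm y ∈ (extChartAt I x').source := by
  simp only [PartialEquiv.trans_source, PartialEquiv.symm_source, Set.mem_inter_iff,
    Set.mem_preimage]

omit [IsManifold I ∞ M] in
theorem isOpen_coordChange_source (x x' : M) :
    IsOpen ((extChartAt I x).symm.trans (extChartAt I x')).source := by
  rw [PartialEquiv.trans_source]
  exact (continuousOn_extChartAt_symm x).isOpen_inter_preimage (isOpen_extChartAt_target x)
    (isOpen_extChartAt_source x')

omit [I.Boundaryless] in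
theorem contDiffOn_coordChange (x x' : M) :
    ContDiffOn ℝ ∞ (extChartAt I x' ∘ (extChartAt I x).symm)
      ((extChartAt I x).symm.trans (extChartAt I x')).source :=
  contDiffOn_ext_coord_change x' x

theorem mfderiv_extChartAt_symm_eq_comp (x x' : M) {y : E}
    (hy : y ∈ ((extChartAt I x).symm.trans (extChartAt I x')).source) :
    (mfderiv 𝓘(ℝ, E) I (extChartAt I x).symm y : E →L[ℝ] E) =
      (mfderiv 𝓘(ℝ, E) I (extChartAt I x').symm
        ((extChartAt I x' ∘ (extChartAt I x).symm) y) : E →L[ℝ] E).comp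
        (fderiv ℝ (extChartAt I x' ∘ (extChartAt I x).symm) y) := by
  have hd := ((contDiffOn_coordChange x x').contDiffAt
    ((isOpen_coordChange_source x x').mem_nhds hy)).differentiableAt (by simp)
  have hev : (extChartAt I x).symm =ᶠ[nhds y]
      (extChartAt I x').symm ∘ (extChartAt I x' ∘ (extChartAt I x).symm) := by
    filter_upwards [(isOpen_coordChange_source x x').mem_nhds hy] with z hz
    exact ((extChartAt I x').left_inv (mem_coordChange_source.1 hz).2).symm
  have hcomp := mfderiv_comp y (mdifferentiableAt_extChartAt_symm (I := I) x'
    ((extChartAt I x').map_source (mem_coordChange_source.1 hy).2)) hd.mdifferentiableAt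
  have hf : (mfderiv 𝓘(ℝ, E) 𝓘(ℝ, E) (extChartAt I x' ∘ (extChartAt I x).symm) y : E →L[ℝ] E) =
      fderiv ℝ (extChartAt I x' ∘ (extChartAt I x).symm) y := mfderiv_eq_fderiv
  exact (hev.mfderiv_eq.trans hcomp).trans (congrArg (fun B : E →L[ℝ] E =>
    (mfderiv 𝓘(ℝ, E) I (extChartAt I x').symm
      ((extChartAt I x' ∘ (extChartAt I x).symm) y) : E →L[ℝ] E).comp B) hf)

/-- The change of coordinates from the chart around `x` to the chart around `x'`. -/
theorem isLocalDiffeoOn_coordChange (x x' : M) :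
    IsLocalDiffeoOn (extChartAt I x' ∘ (extChartAt I x).symm)
      ((extChartAt I x).symm.trans (extChartAt I x')).source (extChartAt I x').target where
  isOpen := isOpen_coordChange_source x x'
  contDiffOn := contDiffOn_coordChange x x'
  mapsTo y hy := (extChartAt I x').map_source (mem_coordChange_source.1 hy).2
  isInvertible y hy := by
    have h1 : (mfderiv 𝓘(ℝ, E) I (extChartAt I x).symm y : E →L[ℝ] E).IsInvertible :=
      isInvertible_mfderiv_extChartAt_symm x (mem_coordChange_source.1 hy).1
    have h2 : (mfderiv 𝓘(ℝ, E) I (extChartAt I x').symm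
        ((extChartAt I x' ∘ (extChartAt I x).symm) y) : E →L[ℝ] E).IsInvertible :=
      isInvertible_mfderiv_extChartAt_symm x'
        ((extChartAt I x').map_source (mem_coordChange_source.1 hy).2)
    rw [mfderiv_extChartAt_symm_eq_comp x x' hy] at h1
    exact isInvertible_of_comp h2 h1

/-- The coordinate expressions of a tensor field in two charts are related by pullback. -/
theorem coordMetric_eq_pullbackMetric (g : BilinField I M) (x x' : M) {y : E}
    (hy : y ∈ ((extChartAt I x).symm.trans (extChartAt I x')).source) :
    coordMetric g x y =
      pullbackMetric (extChartAt I x' ∘ (extChartAt I x).symm) (coordMetric g x') y := by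
  ext v w
  exact bilinField_congr (F := E) g
    ((extChartAt I x').left_inv (mem_coordChange_source.1 hy).2).symm
    (mfderiv_extChartAt_symm_eq_comp x x' hy) v w

variable [FiniteDimensional ℝ E]

/-- If the Ricci tensor, computed at each point in the chart around that point, is proportional to
the metric, then so it is in any fixed chart. -/
theorem coordRicci_coordMetric_eq_of_ricci_eq {g : BilinField I M}
    (hg : ∀ x, IsMetricOn (coordMetric g x) (extChartAt I x).target) {l : M → ℝ}
    (hl : ∀ x (v w : TangentSpace I x), ricci g x v w = l x * g x v w) (x : M) {y : E}
    (hy : y ∈ (extChartAt I x).target) (v w : E) :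
    coordRicci (coordMetric g x) y v w =
      l ((extChartAt I x).symm y) * coordMetric g x y v w := by
  set x' := (extChartAt I x).symm y with hx'
  have hyV : y ∈ ((extChartAt I x).symm.trans (extChartAt I x')).source := by
    exact mem_coordChange_source.2 ⟨hy, mem_extChartAt_source x'⟩
  have hφ := isLocalDiffeoOn_coordChange (I := I) x x'
  rw [coordRicci_congr (Filter.eventually_of_mem (hφ.mem_nhds hyV)
    fun z hz => coordMetric_eq_pullbackMetric g x x' hz), hφ.coordRicci_pullback (hg x') hyV,
    coordMetric_eq_pullbackMetric g x x' hyV, pullbackMetric_apply]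
  simp only [Function.comp_apply, ← hx']
  rw [← ricci_eq, coordMetric_self]
  exact hl _ _ _

/-- Schur's lemma: in dimension greater than `2`, the Ricci tensor can be proportional to the metric
only with a constant factor. -/
theorem exists_eq_const_of_ricci_eq [ConnectedSpace M] {g : BilinField I M}
    (hg : ∀ x, IsMetricOn (coordMetric g x) (extChartAt I x).target)
    (hdim : 2 < Module.finrank ℝ E) {l : M → ℝ}
    (hl : ∀ x (v w : TangentSpace I x), ricci g x v w = l x * g x v w) : ∃ c, ∀ x, l x = c := by
  have : Nontrivial E := Module.nontrivial_of_finrank_pos (R := ℝ) (by omega)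
  have hloc : IsLocallyConstant l := by
    rw [IsLocallyConstant.iff_eventually_eq]
    intro x
    obtain ⟨ε, hε, hball⟩ := Metric.isOpen_iff.1 (hg x).isOpen _ (mem_extChartAt_target (I := I) x)
    have hl' := fun z hz v w => coordRicci_coordMetric_eq_of_ricci_eq hg hl x (y := z) hz v w
    have hconst : ∀ z ∈ Metric.ball (extChartAt I x x) ε,
        l ((extChartAt I x).symm z) = l ((extChartAt I x).symm (extChartAt I x x)) := by
      intro z hz
      refine Metric.isOpen_ball.is_const_of_fderiv_eq_zero (𝕜 := ℝ)
        (f := fun z => l ((extChartAt I x).symm z))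
        (convex_ball _ ε).isPreconnected (fun y hy => ?_) (fun y hy => ?_) hz
        (Metric.mem_ball_self hε)
      · exact ((hg x).differentiableAt_of_coordRicci_eq_smul (hball hy) hl').differentiableWithinAt
      · exact (hg x).schur (hball hy) hdim hl'
    filter_upwards [(continuousAt_extChartAt (I := I) x).preimage_mem_nhds
      (Metric.ball_mem_nhds _ hε), extChartAt_source_mem_nhds (I := I) x] with z hz hz'
    have := hconst _ hz
    rwa [(extChartAt I x).left_inv hz', extChartAt_to_inv] at this
  obtain ⟨x₀⟩ := (inferInstance : Nonempty M)
  exact ⟨l x₀, fun x => hloc.apply_eq_of_preconnectedSpace x x₀⟩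

omit [FiniteDimensional ℝ E] in
theorem contMDiffOn_mfderiv_extChartAt_symm (x : M) (v : E) :
    ContMDiffOn 𝓘(ℝ, E) I.tangent ∞ (fun y => (Bundle.TotalSpace.mk' E ((extChartAt I x).symm y)
      (mfderiv 𝓘(ℝ, E) I (extChartAt I x).symm y v) : TangentBundle I M))
      (extChartAt I x).target := by
  have h1 := (contMDiffOn_extChartAt_symm (I := I) (n := ∞) x).contMDiffOn_tangentMapWithin
    (m := ∞) (by simp) (isOpen_extChartAt_target x).uniqueMDiffOn
  have h2 : ContMDiff 𝓘(ℝ, E) 𝓘(ℝ, E).tangent ∞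
      (fun y : E => (⟨y, v⟩ : TangentBundle 𝓘(ℝ, E) E)) :=
    contMDiff_vectorSpace_iff_contDiff.2 contDiff_const
  refine (h1.comp h2.contMDiffOn fun y hy => hy).congr fun y hy => ?_
  simp only [Function.comp_apply, tangentMapWithin]
  rw [mfderivWithin_of_isOpen (isOpen_extChartAt_target x) hy]

/-- The coordinate expression of a smooth Riemannian metric is smooth and nondegenerate. -/
theorem isMetricOn_coordMetric
    (g : Bundle.ContMDiffRiemannianMetric I ∞ E (fun x : M => TangentSpace I x)) (x : M) :
    IsMetricOn (coordMetric g.inner x) (extChartAt I x).target where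
  isOpen := isOpen_extChartAt_target x
  contDiffOn := by
    rw [contDiffOn_clm_apply]
    intro v
    rw [contDiffOn_clm_apply]
    intro w
    have h1 := g.contMDiff.comp_contMDiffOn (contMDiffOn_extChartAt_symm (I := I) (n := ∞) x)
    have h2 := ContMDiffOn.clm_bundle_apply₂ (F₁ := E) (F₂ := E) (F₃ := ℝ)
      (E₃ := Bundle.Trivial M ℝ) h1
      (contMDiffOn_mfderiv_extChartAt_symm x v) (contMDiffOn_mfderiv_extChartAt_symm x w)
    intro y hy
    have h3 := h2 y hy
    rw [Bundle.contMDiffWithinAt_totalSpace] at h3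
    exact h3.2.contDiffWithinAt
  symm y hy v w := g.symm _ _ _
  isInvertible y hy := by
    apply isInvertible_of_nondegenerate
    intro v hv
    by_contra hv0
    have h1 : mfderiv 𝓘(ℝ, E) I (extChartAt I x).symm y v ≠ 0 := fun h =>
      hv0 ((isInvertible_mfderiv_extChartAt_symm x hy).injective (h.trans (map_zero _).symm))
    exact (g.pos _ _ h1).ne' (hv v)

end Charts

/-! ### Conformal and product metrics on manifolds -/

section ConformalOnManifold

variable {E : Type*} [NormedAddCommGroup E] [NormedSpace ℝ E] [FiniteDimensional ℝ E]
  {H : Type*} [TopologicalSpace H] {I : ModelWithCorners ℝ E H} [I.Boundaryless]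
  {M : Type*} [TopologicalSpace M] [ChartedSpace H M] [IsManifold I ∞ M]
  {g : BilinField I M} (hg : ∀ x, IsMetricOn (coordMetric g x) (extChartAt I x).target)
  {ρ : M → ℝ} (hρ : ContMDiff I 𝓘(ℝ, ℝ) ∞ ρ) (hpos : ∀ x, 0 < ρ x)

omit [FiniteDimensional ℝ E] [I.Boundaryless] [IsManifold I ∞ M] in
theorem coordMetric_conformal (g : BilinField I M) (ρ : M → ℝ) (x : M) :
    coordMetric (conformal ρ g) x =
      fun y => (((ρ ∘ (extChartAt I x).symm) y) ^ 2)⁻¹ • coordMetric g x y := rfl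

include hg hρ hpos

omit [FiniteDimensional ℝ E] [I.Boundaryless] in
theorem isMetricOn_coordMetric_conformal (x : M) :
    IsMetricOn (coordMetric (conformal ρ g) x) (extChartAt I x).target :=
  (hg x).smul (((contDiffOn_comp_extChartAt_symm hρ x).pow 2).inv fun _ _ =>
    (pow_pos (hpos _) 2).ne') fun _ _ => (inv_pos.2 (pow_pos (hpos _) 2)).ne'

/-- The Ricci tensor of `ρ⁻² g`. -/
theorem ricci_conformal (x : M) (v w : E) :
    ricci (conformal ρ g) x v w = ricci g x v w
      + ((Module.finrank ℝ E : ℝ) - 2) * ((hessian g ρ x : E →L[ℝ] E →L[ℝ] ℝ) v w / ρ x)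
      - (laplacian g ρ x / ρ x + ((Module.finrank ℝ E : ℝ) - 1) * gradNormSq g ρ x / ρ x ^ 2) *
        (g x : E →L[ℝ] E →L[ℝ] ℝ) v w := by
  have key := (hg x).coordRicci_conformal (contDiffOn_comp_extChartAt_symm hρ x)
    (fun _ => hpos _) (mem_extChartAt_target x) v w
  rw [← coordMetric_conformal, ← ricci_eq, ← ricci_eq, ← hessian_eq, ← laplacian_eq,
    ← gradNormSq_eq g hρ, coordMetric_self] at key
  simp only [Function.comp_apply, extChartAt_to_inv] at key
  exact key

end ConformalOnManifold

section ProductOnManifold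

variable {E : Type*} [NormedAddCommGroup E] [NormedSpace ℝ E]
  {H : Type*} [TopologicalSpace H] {I : ModelWithCorners ℝ E H} [I.Boundaryless]
  {M : Type*} [TopologicalSpace M] [ChartedSpace H M] [IsManifold I ∞ M]
  {E' : Type*} [NormedAddCommGroup E'] [NormedSpace ℝ E']
  {H' : Type*} [TopologicalSpace H'] {J : ModelWithCorners ℝ E' H'} [J.Boundaryless]
  {N : Type*} [TopologicalSpace N] [ChartedSpace H' N] [IsManifold J ∞ N]
  {gM : BilinField I M} {gN : BilinField J N}

omit [I.Boundaryless] [IsManifold I ∞ M] [J.Boundaryless] [IsManifold J ∞ N] in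
theorem productMetric_apply (gM : BilinField I M) (gN : BilinField J N) (z : M × N)
    (v w : E × E') :
    (productMetric gM gN z : E × E' →L[ℝ] E × E' →L[ℝ] ℝ) v w =
      (gM z.1 : E →L[ℝ] E →L[ℝ] ℝ) v.1 w.1 + (gN z.2 : E' →L[ℝ] E' →L[ℝ] ℝ) v.2 w.2 := by
  rw [productMetric, mfderiv_fst, mfderiv_snd]
  rfl

omit [I.Boundaryless] [IsManifold I ∞ M] [J.Boundaryless] [IsManifold J ∞ N] in
theorem mem_extChartAt_prod_target {z : M × N} {y : E × E'} :
    y ∈ (extChartAt (I.prod J) z).target ↔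
      y ∈ (extChartAt I z.1).target ×ˢ (extChartAt J z.2).target := by
  rw [extChartAt_prod, PartialEquiv.prod_target]

/-- The product chart: the metric of a product is the product of the metrics in coordinates. -/
theorem coordMetric_productMetric (gM : BilinField I M) (gN : BilinField J N) (z : M × N)
    {y : E × E'} (hy : y ∈ (extChartAt (I.prod J) z).target) :
    coordMetric (productMetric gM gN) z y =
      coordProduct (coordMetric gM z.1) (coordMetric gN z.2) y := by
  have hy' := mem_extChartAt_prod_target.1 hy
  have hs := mdifferentiableAt_extChartAt_symm z hy
  have hp1 : (Prod.fst : M × N → M) ∘ (extChartAt (I.prod J) z).symm =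
      (extChartAt I z.1).symm ∘ Prod.fst := by
    rw [extChartAt_prod]; rfl
  have hp2 : (Prod.snd : M × N → N) ∘ (extChartAt (I.prod J) z).symm =
      (extChartAt J z.2).symm ∘ Prod.snd := by
    rw [extChartAt_prod]; rfl
  have hd1 : MDifferentiableAt 𝓘(ℝ, E × E') 𝓘(ℝ, E) (Prod.fst : E × E' → E) y :=
    differentiableAt_fst.mdifferentiableAt
  have hd2 : MDifferentiableAt 𝓘(ℝ, E × E') 𝓘(ℝ, E') (Prod.snd : E × E' → E') y :=
    differentiableAt_snd.mdifferentiableAt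
  have hm1 := mfderiv_comp y (mdifferentiableAt_fst (I := I) (I' := J)) hs
  have hm1' := mfderiv_comp y (mdifferentiableAt_extChartAt_symm (I := I) z.1 hy'.1)
    hd1
  have hm2 := mfderiv_comp y (mdifferentiableAt_snd (I := I) (I' := J)) hs
  have hm2' := mfderiv_comp y (mdifferentiableAt_extChartAt_symm (I := J) z.2 hy'.2)
    hd2
  rw [hp1] at hm1
  rw [hp2] at hm2
  have hf1 : mfderiv 𝓘(ℝ, E × E') 𝓘(ℝ, E) (Prod.fst : E × E' → E) y =
      ContinuousLinearMap.fst ℝ E E' := by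
    rw [mfderiv_eq_fderiv]; exact fderiv_fst
  have hf2 : mfderiv 𝓘(ℝ, E × E') 𝓘(ℝ, E') (Prod.snd : E × E' → E') y =
      ContinuousLinearMap.snd ℝ E E' := by
    rw [mfderiv_eq_fderiv]; exact fderiv_snd
  rw [hf1] at hm1'
  rw [hf2] at hm2'
  refine ContinuousLinearMap.ext fun v => ContinuousLinearMap.ext fun w => ?_
  exact congrArg₂ (· + ·)
    (bilinField_congr gM (congrFun hp1 y) (hm1.symm.trans hm1') v w)
    (bilinField_congr gN (congrFun hp2 y) (hm2.symm.trans hm2') v w)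

theorem coordMetric_productMetric_eventuallyEq (gM : BilinField I M) (gN : BilinField J N)
    (z : M × N) :
    coordMetric (productMetric gM gN) z =ᶠ[nhds (extChartAt (I.prod J) z z)]
      coordProduct (coordMetric gM z.1) (coordMetric gN z.2) :=
  Filter.eventually_of_mem (extChartAt_target_mem_nhds z) fun _ hy =>
    coordMetric_productMetric gM gN z hy

variable [FiniteDimensional ℝ E] [FiniteDimensional ℝ E']
  (hM : ∀ x, IsMetricOn (coordMetric gM x) (extChartAt I x).target)
  (hN : ∀ x, IsMetricOn (coordMetric gN x) (extChartAt J x).target)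
include hM hN

theorem isMetricOn_coordMetric_productMetric (z : M × N) :
    IsMetricOn (coordMetric (productMetric gM gN) z) (extChartAt (I.prod J) z).target := by
  have ht : (extChartAt (I.prod J) z).target =
      (extChartAt I z.1).target ×ˢ (extChartAt J z.2).target :=
    Set.ext fun y => mem_extChartAt_prod_target
  rw [ht]
  exact ((hM z.1).prod (hN z.2)).congr fun y hy =>
    coordMetric_productMetric gM gN z (mem_extChartAt_prod_target.2 hy)

theorem ricci_productMetric (z : M × N) (v w : E × E') :
    ricci (productMetric gM gN) z v w = ricci gM z.1 v.1 w.1 + ricci gN z.2 v.2 w.2 := by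
  rw [ricci_eq, ricci_eq, ricci_eq,
    coordRicci_congr (coordMetric_productMetric_eventuallyEq gM gN z),
    (hM z.1).coordRicci_coordProduct (hN z.2)
      (mem_extChartAt_prod_target.1 (mem_extChartAt_target z))]
  rw [extChartAt_prod]
  rfl

variable {ρ : M → ℝ} (hρ : ContMDiff I 𝓘(ℝ, ℝ) ∞ ρ)
include hρ

theorem hessian_productMetric (z : M × N) (v w : E × E') :
    (hessian (productMetric gM gN) (fun z : M × N => ρ z.1) z : E × E' →L[ℝ] E × E' →L[ℝ] ℝ) v w =
      (hessian gM ρ z.1 : E →L[ℝ] E →L[ℝ] ℝ) v.1 w.1 := by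
  have key := (hM z.1).coordHessian_coordProduct (hN z.2) (contDiffOn_comp_extChartAt_symm hρ z.1)
    (mem_extChartAt_prod_target.1 (mem_extChartAt_target z)) v w
  rw [hessian_eq, hessian_eq, coordHessian_congr (coordMetric_productMetric_eventuallyEq gM gN z)]
  rw [extChartAt_prod] at key ⊢
  exact key

theorem laplacian_productMetric (z : M × N) :
    laplacian (productMetric gM gN) (fun z : M × N => ρ z.1) z = laplacian gM ρ z.1 := by
  have key := (hM z.1).coordLaplacian_coordProduct (hN z.2)
    (contDiffOn_comp_extChartAt_symm hρ z.1)
    (mem_extChartAt_prod_target.1 (mem_extChartAt_target z))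
  rw [laplacian_eq, laplacian_eq, coordLaplacian,
    coordHessian_congr (coordMetric_productMetric_eventuallyEq gM gN z),
    coordMetric_productMetric gM gN z (mem_extChartAt_target z)]
  rw [extChartAt_prod] at key ⊢
  exact key

theorem gradNormSq_productMetric (z : M × N) :
    gradNormSq (productMetric gM gN) (fun z : M × N => ρ z.1) z = gradNormSq gM ρ z.1 := by
  have key := (hM z.1).coordGradNormSq_coordProduct (hN z.2)
    (contDiffOn_comp_extChartAt_symm hρ z.1)
    (mem_extChartAt_prod_target.1 (mem_extChartAt_target z))
  have hρ' : ContMDiff (I.prod J) 𝓘(ℝ, ℝ) ∞ (fun z : M × N => ρ z.1) := hρ.comp contMDiff_fst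
  rw [gradNormSq_eq _ hρ', gradNormSq_eq _ hρ, coordGradNormSq,
    coordMetric_productMetric gM gN z (mem_extChartAt_target z)]
  rw [extChartAt_prod] at key ⊢
  exact key

/-- The Ricci tensor of `ρ⁻² (g_M + g_N)`. -/
theorem ricci_conformal_productMetric (hpos : ∀ x, 0 < ρ x) (z : M × N) (v w : E × E') :
    ricci (conformal (fun z : M × N => ρ z.1) (productMetric gM gN)) z v w =
      ricci gM z.1 v.1 w.1 + ricci gN z.2 v.2 w.2
      + ((Module.finrank ℝ E + Module.finrank ℝ E' : ℝ) - 2) *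
        ((hessian gM ρ z.1 : E →L[ℝ] E →L[ℝ] ℝ) v.1 w.1 / ρ z.1)
      - (laplacian gM ρ z.1 / ρ z.1 + ((Module.finrank ℝ E + Module.finrank ℝ E' : ℝ) - 1) *
          gradNormSq gM ρ z.1 / ρ z.1 ^ 2) *
        ((gM z.1 : E →L[ℝ] E →L[ℝ] ℝ) v.1 w.1 + (gN z.2 : E' →L[ℝ] E' →L[ℝ] ℝ) v.2 w.2) := by
  have hρ' : ContMDiff (I.prod J) 𝓘(ℝ, ℝ) ∞ (fun z : M × N => ρ z.1) := hρ.comp contMDiff_fst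
  refine (ricci_conformal (isMetricOn_coordMetric_productMetric hM hN) hρ'
    (fun z => hpos z.1) z v w).trans ?_
  rw [ricci_productMetric hM hN, laplacian_productMetric hM hN hρ,
    gradNormSq_productMetric hM hN hρ, Module.finrank_prod, Nat.cast_add,
    hessian_productMetric hM hN hρ, productMetric_apply]

end ProductOnManifold

/-! ### The Einstein condition for `ρ⁻² (g_M + g_N)` -/

section Einstein

theorem coordRicci_zero_zero {E : Type*} [NormedAddCommGroup E] [NormedSpace ℝ E]
    (G : E → E →L[ℝ] E →L[ℝ] ℝ) (y : E) : coordRicci G y 0 0 = 0 := by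
  have : curvature G y 0 0 = 0 := by
    ext u
    simp [curvature_apply]
  rw [coordRicci, this]
  exact map_zero _

variable {m n : ℕ}
    {M : Type*} [TopologicalSpace M] [ChartedSpace (EuclideanSpace ℝ (Fin m)) M]
    [IsManifold (𝓡 m) ∞ M]
    {N : Type*} [TopologicalSpace N] [ChartedSpace (EuclideanSpace ℝ (Fin n)) N]
    [IsManifold (𝓡 n) ∞ N]

theorem ricci_zero_zero (g : BilinField (𝓡 m) M) (x : M) : ricci g x 0 0 = 0 :=
  (ricci_eq g x 0 0).trans (coordRicci_zero_zero _ _)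

/-- The function `Δρ / ρ + (p - 1) |dρ|² / ρ²`. The Einstein constant of `ρ⁻² g` is
`(ε - conformalTerm) ρ²`. -/
def conformalTerm (p : ℕ) (g : BilinField (𝓡 m) M) (ρ : M → ℝ) (x : M) : ℝ :=
  laplacian g ρ x / ρ x + ((p : ℝ) - 1) * gradNormSq g ρ x / ρ x ^ 2

omit [IsManifold (𝓡 m) ∞ M] in
theorem sub_conformalTerm_mul_sq {p : ℕ} {g : BilinField (𝓡 m) M} {ρ : M → ℝ}
    (hpos : ∀ x, 0 < ρ x) (ε : ℝ) (x : M) :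
    (ε - conformalTerm p g ρ x) * ρ x ^ 2 =
      ε * ρ x ^ 2 - ρ x * laplacian g ρ x - ((p : ℝ) - 1) * gradNormSq g ρ x := by
  have := (hpos x).ne'
  rw [conformalTerm]
  field_simp
  ring

theorem exists_inner_self_ne_zero (hn : 0 < n) (g : SmoothMetric n N) (y : N) :
    ∃ v : EuclideanSpace ℝ (Fin n),
      (g.inner y : EuclideanSpace ℝ (Fin n) →L[ℝ] _ →L[ℝ] ℝ) v v ≠ 0 := by
  have : Nonempty (Fin n) := ⟨⟨0, hn⟩⟩
  obtain ⟨v, hv⟩ := exists_ne (0 : EuclideanSpace ℝ (Fin n))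
  exact ⟨v, (g.pos y v hv).ne'⟩

variable {gM : SmoothMetric m M} {gN : SmoothMetric n N} {ρ : M → ℝ}
  (hρ : ContMDiff (𝓡 m) 𝓘(ℝ, ℝ) ∞ ρ) (hpos : ∀ x, 0 < ρ x)
include hρ hpos

theorem ricci_conformal_inner (x : M) (v w : EuclideanSpace ℝ (Fin m)) :
    ricci (conformal ρ gM.inner) x v w = ricci gM.inner x v w
      + ((m : ℝ) - 2) * (hessian gM.inner ρ x v w / ρ x)
      - conformalTerm m gM.inner ρ x * gM.inner x v w := by
  have := ricci_conformal (isMetricOn_coordMetric gM) hρ hpos x v w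
  rw [finrank_euclideanSpace_fin] at this
  exact this

theorem ricci_conformal_product_inner (z : M × N)
    (v w : EuclideanSpace ℝ (Fin m) × EuclideanSpace ℝ (Fin n)) :
    ricci (conformal (fun z : M × N => ρ z.1) (productMetric gM.inner gN.inner)) z v w =
      ricci gM.inner z.1 v.1 w.1 + ricci gN.inner z.2 v.2 w.2
      + (((m + n : ℕ) : ℝ) - 2) * (hessian gM.inner ρ z.1 v.1 w.1 / ρ z.1)
      - conformalTerm (m + n) gM.inner ρ z.1 *
        (gM.inner z.1 v.1 w.1 + gN.inner z.2 v.2 w.2) := by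
  have := ricci_conformal_productMetric (isMetricOn_coordMetric gM) (isMetricOn_coordMetric gN)
    hρ hpos z v w
  rw [finrank_euclideanSpace_fin, finrank_euclideanSpace_fin] at this
  rw [conformalTerm, Nat.cast_add]
  exact this

theorem isEinstein_conformal_iff {c : ℝ} :
    IsEinstein (conformal ρ gM.inner) c ↔ ∀ (x : M) (v w : EuclideanSpace ℝ (Fin m)),
      ricci gM.inner x v w + ((m : ℝ) - 2) * (hessian gM.inner ρ x v w / ρ x) =
        (c * (ρ x ^ 2)⁻¹ + conformalTerm m gM.inner ρ x) * gM.inner x v w := by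
  refine forall_congr' fun x => forall_congr' fun v => forall_congr' fun w => ?_
  have h1 := ricci_conformal_inner (gM := gM) hρ hpos x v w
  have h2 : conformal ρ gM.inner x v w = (ρ x ^ 2)⁻¹ * gM.inner x v w := rfl
  rw [h2]
  refine (Eq.congr_left h1).trans ?_
  rw [sub_eq_iff_eq_add, add_mul, mul_assoc c]

theorem isEinstein_conformal_product_iff {c : ℝ} :
    IsEinstein (conformal (fun z : M × N => ρ z.1) (productMetric gM.inner gN.inner)) c ↔
      ∀ (x : M) (y : N) (v w : EuclideanSpace ℝ (Fin m)) (v' w' : EuclideanSpace ℝ (Fin n)),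
      ricci gM.inner x v w + ricci gN.inner y v' w'
        + (((m + n : ℕ) : ℝ) - 2) * (hessian gM.inner ρ x v w / ρ x) =
        (c * (ρ x ^ 2)⁻¹ + conformalTerm (m + n) gM.inner ρ x) *
          (gM.inner x v w + gN.inner y v' w') := by
  have key (z : M × N) (v w : EuclideanSpace ℝ (Fin m) × EuclideanSpace ℝ (Fin n)) :
      ricci (conformal (fun z : M × N => ρ z.1) (productMetric gM.inner gN.inner)) z v w =
        c * conformal (fun z : M × N => ρ z.1) (productMetric gM.inner gN.inner) z v w ↔
      ricci gM.inner z.1 v.1 w.1 + ricci gN.inner z.2 v.2 w.2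
        + (((m + n : ℕ) : ℝ) - 2) * (hessian gM.inner ρ z.1 v.1 w.1 / ρ z.1) =
        (c * (ρ z.1 ^ 2)⁻¹ + conformalTerm (m + n) gM.inner ρ z.1) *
          (gM.inner z.1 v.1 w.1 + gN.inner z.2 v.2 w.2) := by
    have h2 : conformal (fun z : M × N => ρ z.1) (productMetric gM.inner gN.inner) z v w =
        (ρ z.1 ^ 2)⁻¹ * (gM.inner z.1 v.1 w.1 + gN.inner z.2 v.2 w.2) :=
      congrArg _ (productMetric_apply gM.inner gN.inner z v w)
    rw [h2]
    refine (Eq.congr_left (ricci_conformal_product_inner hρ hpos z v w)).trans ?_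
    rw [sub_eq_iff_eq_add, add_mul _ _ (gM.inner z.1 v.1 w.1 + gN.inner z.2 v.2 w.2), mul_assoc c]
  exact ⟨fun h x y v w v' w' => (key (x, y) (v, v') (w, w')).1 (h (x, y) (v, v') (w, w')),
    fun h z v w => (key z v w).2 (h z.1 z.2 v.1 w.1 v.2 w.2)⟩

/-- By Schur's lemma it suffices that `ρ⁻² g_M` be Einstein with a variable Einstein constant. -/
theorem exists_isEinstein_conformal [ConnectedSpace M] (hm : 2 < m) {ε : ℝ}
    (hε : QuasiEinsteinLike m gM.inner ρ ε) :
    ∃ c : ℝ, IsEinstein (conformal ρ gM.inner) c := by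
  obtain ⟨c, hc⟩ := exists_eq_const_of_ricci_eq (g := conformal ρ gM.inner)
    (isMetricOn_coordMetric_conformal (isMetricOn_coordMetric gM) hρ hpos)
    (by rwa [finrank_euclideanSpace_fin])
    (l := fun x => (ε - conformalTerm m gM.inner ρ x) * ρ x ^ 2) fun x v w => by
      have h1 := ricci_conformal_inner (gM := gM) hρ hpos x v w
      have h2 : conformal ρ gM.inner x v w = (ρ x ^ 2)⁻¹ * gM.inner x v w := rfl
      have := (hpos x).ne'
      refine h1.trans ?_
      rw [hε x v w, h2]
      field_simp
  refine ⟨c, (isEinstein_conformal_iff hρ hpos).2 fun x v w => ?_⟩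
  have := (hpos x).ne'
  rw [hε x v w, ← hc x]
  field_simp
  ring

/-- If `g_N` is Einstein and `g_M` satisfies the equation with the same constant `ε`, then
`ρ⁻² (g_M + g_N)` has Ricci tensor `(ε - conformalTerm) ρ²` times itself, and Schur's lemma on
`M × N` shows that this factor is constant. -/
theorem exists_isEinstein_conformal_product [ConnectedSpace M] [ConnectedSpace N]
    (hp : 2 < m + n) {ε : ℝ} (hN : IsEinstein gN.inner ε)
    (hε : QuasiEinsteinLike (m + n) gM.inner ρ ε) :
    ∃ c : ℝ, IsEinstein
      (conformal (fun z : M × N => ρ z.1) (productMetric gM.inner gN.inner)) c := by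
  have hρ' : ContMDiff ((𝓡 m).prod (𝓡 n)) 𝓘(ℝ, ℝ) ∞ (fun z : M × N => ρ z.1) :=
    hρ.comp contMDiff_fst
  have hsum (x : M) (y : N) (v w : EuclideanSpace ℝ (Fin m)) (v' w' : EuclideanSpace ℝ (Fin n)) :
      ricci gM.inner x v w + ricci gN.inner y v' w'
        + (((m + n : ℕ) : ℝ) - 2) * (hessian gM.inner ρ x v w / ρ x) =
      ε * (gM.inner x v w + gN.inner y v' w') := by
    rw [hN y v' w', add_right_comm, hε x v w]
    ring
  obtain ⟨c, hc⟩ := exists_eq_const_of_ricci_eq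
    (g := conformal (fun z : M × N => ρ z.1) (productMetric gM.inner gN.inner))
    (isMetricOn_coordMetric_conformal (isMetricOn_coordMetric_productMetric
      (isMetricOn_coordMetric gM) (isMetricOn_coordMetric gN)) hρ' fun z => hpos z.1)
    (by rwa [Module.finrank_prod, finrank_euclideanSpace_fin, finrank_euclideanSpace_fin])
    (l := fun z => (ε - conformalTerm (m + n) gM.inner ρ z.1) * ρ z.1 ^ 2) fun z v w => by
      have h2 : conformal (fun z : M × N => ρ z.1) (productMetric gM.inner gN.inner) z v w =
          (ρ z.1 ^ 2)⁻¹ * (gM.inner z.1 v.1 w.1 + gN.inner z.2 v.2 w.2) :=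
        congrArg _ (productMetric_apply gM.inner gN.inner z v w)
      have := (hpos z.1).ne'
      refine (ricci_conformal_product_inner hρ hpos z v w).trans ?_
      rw [hsum, h2]
      field_simp
  refine ⟨c, (isEinstein_conformal_product_iff hρ hpos).2 fun x y v w v' w' => ?_⟩
  have := (hpos x).ne'
  rw [hsum, ← hc (x, y)]
  field_simp
  ring

/-- If `ρ⁻² (g_M + g_N)` is Einstein, its Ricci tensor on vectors tangent to `N` is that of `g_N`
up to a function on `M`. -/
theorem ricci_inner_snd_of_isEinstein {c : ℝ}
    (hc : IsEinstein (conformal (fun z : M × N => ρ z.1) (productMetric gM.inner gN.inner)) c)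
    (x : M) (y : N) (v w : EuclideanSpace ℝ (Fin n)) :
    ricci gN.inner y v w =
      (c * (ρ x ^ 2)⁻¹ + conformalTerm (m + n) gM.inner ρ x) * gN.inner y v w := by
  have h := (isEinstein_conformal_product_iff hρ hpos).1 hc x y 0 0 v w
  have h0 : ricci gM.inner x (0 : EuclideanSpace ℝ (Fin m)) (0 : EuclideanSpace ℝ (Fin m)) = 0 :=
    ricci_zero_zero _ _
  have h1 : hessian gM.inner ρ x (0 : EuclideanSpace ℝ (Fin m))
      (0 : EuclideanSpace ℝ (Fin m)) = 0 := map_zero _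
  have h2 : gM.inner x (0 : EuclideanSpace ℝ (Fin m)) (0 : EuclideanSpace ℝ (Fin m)) = 0 :=
    map_zero _
  rwa [h0, h1, h2, zero_add, zero_add, zero_div, mul_zero, add_zero] at h

theorem add_conformalTerm_eq_of_isEinstein [Nonempty N] (hn : 0 < n) {c ε : ℝ}
    (hc : IsEinstein (conformal (fun z : M × N => ρ z.1) (productMetric gM.inner gN.inner)) c)
    (hN : IsEinstein gN.inner ε) (x : M) :
    c * (ρ x ^ 2)⁻¹ + conformalTerm (m + n) gM.inner ρ x = ε := by
  obtain ⟨y⟩ := ‹Nonempty N›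
  obtain ⟨v, hv⟩ := exists_inner_self_ne_zero hn gN y
  exact mul_right_cancel₀ hv
    ((ricci_inner_snd_of_isEinstein hρ hpos hc x y v v).symm.trans (hN y v v))

/-- If `ρ⁻² (g_M + g_N)` is Einstein, then `g_N` is Einstein and `g_M` satisfies the equation
`Ric(g_M) + (p - 2) D dρ / ρ = ε g_M`, with the same constant. -/
theorem exists_isEinstein_and_quasiEinsteinLike [Nonempty M] [Nonempty N] (hn : 0 < n) {c : ℝ}
    (hc : IsEinstein (conformal (fun z : M × N => ρ z.1) (productMetric gM.inner gN.inner)) c) :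
    ∃ ε : ℝ, IsEinstein gN.inner ε ∧ QuasiEinsteinLike (m + n) gM.inner ρ ε := by
  obtain ⟨x₀⟩ := ‹Nonempty M›
  have hN : IsEinstein gN.inner
      (c * (ρ x₀ ^ 2)⁻¹ + conformalTerm (m + n) gM.inner ρ x₀) := fun y v w =>
    ricci_inner_snd_of_isEinstein hρ hpos hc x₀ y v w
  refine ⟨_, hN, fun x v w => ?_⟩
  obtain ⟨y⟩ := ‹Nonempty N›
  have h := (isEinstein_conformal_product_iff hρ hpos).1 hc x y v w 0 0
  have h0 : ricci gN.inner y (0 : EuclideanSpace ℝ (Fin n)) (0 : EuclideanSpace ℝ (Fin n)) = 0 :=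
    ricci_zero_zero _ _
  have h2 : gN.inner y (0 : EuclideanSpace ℝ (Fin n)) (0 : EuclideanSpace ℝ (Fin n)) = 0 :=
    map_zero _
  have : Nonempty N := ⟨y⟩
  rwa [h0, h2, add_zero, add_zero, add_conformalTerm_eq_of_isEinstein hρ hpos hn hc hN x] at h

omit hρ in
/-- The relation between the two Einstein constants, solved for that of `ρ⁻² g`. -/
theorem eq_of_add_conformalTerm_eq {p : ℕ} {c ε : ℝ} {x : M}
    (h : c * (ρ x ^ 2)⁻¹ + conformalTerm p gM.inner ρ x = ε) :
    c = ε * ρ x ^ 2 - ρ x * laplacian gM.inner ρ x - ((p : ℝ) - 1) * gradNormSq gM.inner ρ x := by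
  have := (hpos x).ne'
  rw [← sub_conformalTerm_mul_sq hpos, ← h]
  field_simp
  ring

end Einstein

end ConfEinstein

end

theorem mainTheorem8 (m n : ℕ) (hp : 2 < m + n)
    {M : Type*} [TopologicalSpace M] [T2Space M] [SecondCountableTopology M] [ConnectedSpace M]
    [ChartedSpace (EuclideanSpace ℝ (Fin m)) M] [IsManifold (𝓡 m) ∞ M]
    {N : Type*} [TopologicalSpace N] [T2Space N] [SecondCountableTopology N] [ConnectedSpace N]
    [ChartedSpace (EuclideanSpace ℝ (Fin n)) N] [IsManifold (𝓡 n) ∞ N]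
    (gM : ConfEinstein.SmoothMetric m M) (gN : ConfEinstein.SmoothMetric n N)
    (ρ : M → ℝ) (hρ : ContMDiff (𝓡 m) 𝓘(ℝ, ℝ) ∞ ρ) (hρpos : ∀ x, 0 < ρ x) :
    (0 < n →
      ((∃ c : ℝ, ConfEinstein.IsEinstein
            (ConfEinstein.conformal (fun z : M × N => ρ z.1)
              (ConfEinstein.productMetric gM.inner gN.inner)) c) ↔
        ∃ ε : ℝ, ConfEinstein.IsEinstein gN.inner ε ∧
          ConfEinstein.QuasiEinsteinLike (m + n) gM.inner ρ ε) ∧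
      ∀ c ε : ℝ,
        ConfEinstein.IsEinstein
          (ConfEinstein.conformal (fun z : M × N => ρ z.1)
            (ConfEinstein.productMetric gM.inner gN.inner)) c →
        ConfEinstein.IsEinstein gN.inner ε →
        ∀ x : M, c = ε * ρ x ^ 2 - ρ x * ConfEinstein.laplacian gM.inner ρ x
          - (((m + n : ℕ) : ℝ) - 1) * ConfEinstein.gradNormSq gM.inner ρ x) ∧
    (n = 0 → ∀ ε : ℝ, ConfEinstein.QuasiEinsteinLike (m + n) gM.inner ρ ε →
      (∃ c : ℝ, ConfEinstein.IsEinstein (ConfEinstein.conformal ρ gM.inner) c) ∧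
      ∀ c : ℝ, ConfEinstein.IsEinstein (ConfEinstein.conformal ρ gM.inner) c →
        ∀ x : M, c = ε * ρ x ^ 2 - ρ x * ConfEinstein.laplacian gM.inner ρ x
          - (((m + n : ℕ) : ℝ) - 1) * ConfEinstein.gradNormSq gM.inner ρ x) := by
  refine ⟨fun hn => ⟨⟨?_, ?_⟩, fun c ε hc hN x => ?_⟩, ?_⟩
  · rintro ⟨c, hc⟩
    exact ConfEinstein.exists_isEinstein_and_quasiEinsteinLike hρ hρpos hn hc
  · rintro ⟨ε, hN, hM⟩
    exact ConfEinstein.exists_isEinstein_conformal_product hρ hρpos hp hN hM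
  · exact ConfEinstein.eq_of_add_conformalTerm_eq hρpos
      (ConfEinstein.add_conformalTerm_eq_of_isEinstein hρ hρpos hn hc hN x)
  · rintro rfl ε hε
    refine ⟨ConfEinstein.exists_isEinstein_conformal hρ hρpos hp hε, fun c hc x => ?_⟩
    obtain ⟨v, hv⟩ := ConfEinstein.exists_inner_self_ne_zero (by omega) gM x
    exact ConfEinstein.eq_of_add_conformalTerm_eq hρpos (mul_right_cancel₀ hv
      (((ConfEinstein.isEinstein_conformal_iff hρ hρpos).1 hc x v v).symm.trans (hε x v v)))
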